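/- Let $k$ be a perfect field; a $k$-scheme means a separated scheme of finite type over $k$, and products are over $k$. Let $n, m \ge 1$ be integers. Put $\widehat B_n = \mathbb P^1 \times (\mathbb P^1)^{n-1}$ with coordinates $(t, y_1, \dots, y_{n-1})$, and let $B_n = \mathbb G_m \times (\mathbb P^1 \setminus \{1\})^{n-1} \subset \widehat B_n$. Let $F_{n,0} = \{t = 0\}$, $F^1_{n,i} = \{y_i = 1\}$ and $F^1_n = \sum_{i=1}^{n-1} F^1_{n,i}$, which are Cartier divisors on $\widehat B_n$. Let $X$ be a $k$-scheme. For an integral closed subscheme $V \subset X \times B_n$, let $\overline V$ be its closure in $X \times \widehat B_n$ and let $\nu : \overline V^N \to X \times \widehat B_n$ be the natural morphism from the normalization of $\overline V$. We say that $V$ satisfies $M_{sum}$ if $(m+1)[\nu^* F_{n,0}] \le [\nu^* F^1_n]$ as Weil divisors on $\overline V^N$, and that $V$ satisfies $M_{ssup}$ if there is an $i$ with $1 \le i \le n-1$ and $(m+1)[\nu^* F_{n,0}] \le [\nu^* F^1_{n,i}]$ as Weil divisors on $\overline V^N$. (Divisors on $\widehat B_n$ are first pulled back to $X \times \widehat B_n$.)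 **Proposition (Containment lemma).** Let $V$ and $Y$ be integral closed subschemes of $X \times B_n$ such that the closure $\overline Y \subset X \times \widehat B_n$ intersects $X \times F_{n,0}$ and $X \times F^1_n$ properly, i.e. $\dim(\overline Y \cap (X \times D)) \le \dim \overline Y - 1$ for $D = F_{n,0}, F^1_n$. Let $V_Y$ be an irreducible component of $V \cap Y$, with its reduced structure. 1. If $V$ satisfies $M_{ssup}$, then $V_Y$ satisfies $M_{ssup}$. 2. If $V$ satisfies $M_{sum}$, then $V_Y$ satisfies $M_{sum}$. -/

import Mathlib

open AlgebraicGeometry CategoryTheory CategoryTheory.Limits TopologicalSpace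

universe u

noncomputable section

attribute [local instance] MvPolynomial.gradedAlgebra

namespace AdditiveChow

/-! ### Closed subsets as reduced subschemes, and normalization -/

/-- A closed subset `Z` of a scheme `S`, with its reduced closed subscheme structure. -/
abbrev reducedSubscheme {S : Scheme.{u}} (Z : Closeds S) : Scheme.{u} :=
  (Scheme.IdealSheafData.vanishingIdeal Z).subscheme

/-- The closed immersion of `Z` (with its reduced structure) into `S`. -/
abbrev reducedSubschemeι {S : Scheme.{u}} (Z : Closeds S) : reducedSubscheme Z ⟶ S :=
  (Scheme.IdealSheafData.vanishingIdeal Z).subschemeι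

theorem isReduced_reducedSubscheme {S : Scheme.{u}} (Z : Closeds S) :
    IsReduced (reducedSubscheme Z) := by
  let c := (Scheme.IdealSheafData.vanishingIdeal Z).subschemeCover
  have (i : c.openCover.I₀) : IsReduced (c.openCover.X i) := by
    have h := (Ideal.isRadical_iff_quotient_reduced
      ((Scheme.IdealSheafData.vanishingIdeal Z).ideal i)).mp
        (PrimeSpectrum.isRadical_vanishingIdeal _)
    exact (affine_isReduced_iff _).mpr h
  exact IsReduced.of_openCover _ c.openCover

theorem isIntegral_reducedSubscheme {S : Scheme.{u}} (Z : Closeds S)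
    (hZ : IsIrreducible (Z : Set S)) : IsIntegral (reducedSubscheme Z) := by
  have := isReduced_reducedSubscheme Z
  have : IrreducibleSpace (reducedSubscheme Z) := Subtype.irreducibleSpace hZ
  exact isIntegral_of_irreducibleSpace_of_isReduced _

/-- The inclusion of the generic point of an integral scheme. -/
abbrev genericPointι (Z : Scheme.{u}) [IsIntegral Z] : Spec Z.functionField ⟶ Z :=
  Z.fromSpecStalk (genericPoint Z)

instance (Z : Scheme.{u}) [IsIntegral Z] : QuasiCompact (genericPointι Z) where
  isCompact_preimage U _ _ := by
    have : Subsingleton (Spec Z.functionField) :=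
      inferInstanceAs (Subsingleton (PrimeSpectrum Z.functionField))
    exact (Set.toFinite _).isCompact

instance (Z : Scheme.{u}) [IsIntegral Z] : QuasiSeparated (genericPointι Z) :=
  .of_comp _ (terminal.from Z)

/-- The normalization of an integral scheme `Z`: the relative spectrum of the integral closure of
`𝒪_Z` in the function field of `Z`. -/
def normalization (Z : Scheme.{u}) [IsIntegral Z] : Scheme.{u} :=
  (genericPointι Z).normalization

/-- The normalization morphism. -/
def normalizationMap (Z : Scheme.{u}) [IsIntegral Z] : normalization Z ⟶ Z :=
  (genericPointι Z).fromNormalization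

/-! ### The Weil divisor of an effective Cartier divisor

Effective Cartier divisors are given by their ideal sheaves: sums of divisors are products of
ideal sheaves, and the pull-back of a divisor along a morphism `ν` is given by the inverse image
ideal sheaf (Mathlib's `IdealSheafData.comap`). -/

/-- The stalk at `x` of an ideal sheaf, as an ideal of the local ring at `x`. -/
def stalkIdeal {N : Scheme.{u}} (J : N.IdealSheafData) (x : N) : Ideal (N.presheaf.stalk x) :=
  ⨆ (U : N.affineOpens) (hx : x ∈ U.1), (J.ideal U).map (N.presheaf.germ U.1 x hx).hom

/-- Prime Weil divisors, given by their generic points: the points of codimension one. -/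
abbrev PrimeDivisor (N : Scheme.{u}) : Type u := {x : N // Order.coheight x = 1}

/-- The Weil divisor `[D]` of an effective Cartier divisor `D` with ideal sheaf `J`, given by its
multiplicities. Its multiplicity along a prime divisor with generic point `x` is
the length of `𝒪_{N,x} / J_x`, i.e. the order of vanishing at `x` of a local equation of `D`. -/
def weilDivisor {N : Scheme.{u}} (J : N.IdealSheafData) : PrimeDivisor N → ℕ∞ := fun x =>
  Module.length (N.presheaf.stalk x.1) (N.presheaf.stalk x.1 ⧸ stalkIdeal J x.1)

/-- A closed subset `Z` intersects the effective divisor with ideal sheaf `D` properly: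
`dim (Z ∩ D) ≤ dim Z - 1`. -/
def MeetsProperly {S : Scheme.{u}} (Z : Closeds S) (D : S.IdealSheafData) : Prop :=
  topologicalKrullDim ↥((Z : Set S) ∩ (D.support : Set S)) + 1 ≤ topologicalKrullDim ↥(Z : Set S)

/-! ### The projective line -/

section Field

variable (k : Type u) [Field k]

/-- `ℙ¹ = Proj k[Y₀, Y₁]`. -/
abbrev P1 : Scheme.{u} := Proj (MvPolynomial.homogeneousSubmodule (Fin 2) k)

/-- The structure morphism `ℙ¹ ⟶ Spec k`. -/
def P1.str : P1 k ⟶ Spec (.of k) :=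
  Proj.toSpecZero (MvPolynomial.homogeneousSubmodule (Fin 2) k) ≫
    Spec.map (CommRingCat.ofHom (algebraMap k (MvPolynomial.homogeneousSubmodule (Fin 2) k 0)))

/-- The open subset of `ℙ¹` where a form `l` does not vanish. -/
abbrev P1.nonvanishing (l : MvPolynomial (Fin 2) k) : (P1 k).Opens :=
  Proj.basicOpen (MvPolynomial.homogeneousSubmodule (Fin 2) k) l

/-- The ideal sheaf of the zero locus of a form `l`, with its reduced structure. It is only used
for linear forms, whose zero scheme is a reduced `k`-rational point of `ℙ¹`. -/
def P1.divisor (l : MvPolynomial (Fin 2) k) : (P1 k).IdealSheafData :=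
  Scheme.IdealSheafData.vanishingIdeal (P1.nonvanishing k l).compl

/-- The Cartier divisor `{y = 0}` of `ℙ¹`, where `y = Y₁ / Y₀`. -/
def P1.zero : (P1 k).IdealSheafData := P1.divisor k (MvPolynomial.X 1)

/-- The Cartier divisor `{y = 1}` of `ℙ¹`, where `y = Y₁ / Y₀`. -/
def P1.one : (P1 k).IdealSheafData := P1.divisor k (MvPolynomial.X 1 - MvPolynomial.X 0)

/-- `𝔾ₘ = ℙ¹ \ {0, ∞}`, as an open subset of `ℙ¹`. -/
def P1.Gm : (P1 k).Opens :=
  P1.nonvanishing k (MvPolynomial.X 1) ⊓ P1.nonvanishing k (MvPolynomial.X 0)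

/-- `□ = ℙ¹ \ {1}`, as an open subset of `ℙ¹`. -/
def P1.square : (P1 k).Opens :=
  P1.nonvanishing k (MvPolynomial.X 1 - MvPolynomial.X 0)

/-! ### The space `B̂_n` and its divisors -/

/-- `(ℙ¹)^N`, the `N`-fold fibre power over `Spec k`. -/
abbrev P1Pow (N : ℕ) : Scheme.{u} :=
  widePullback (Spec (.of k)) (fun _ : Fin N => P1 k) (fun _ => P1.str k)

/-- The structure morphism `(ℙ¹)^N ⟶ Spec k`. -/
abbrev P1Pow.str (N : ℕ) : P1Pow k N ⟶ Spec (.of k) :=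
  WidePullback.base (fun _ : Fin N => P1.str k)

/-- `B̂_n = ℙ¹ × (ℙ¹)^(n-1)`, for `n ≥ 1`. -/
abbrev Bhat (n : ℕ) : Scheme.{u} := pullback (P1.str k) (P1Pow.str k (n - 1))

/-- The structure morphism `B̂_n ⟶ Spec k`. -/
abbrev Bhat.str (n : ℕ) : Bhat k n ⟶ Spec (.of k) :=
  pullback.fst (P1.str k) (P1Pow.str k (n - 1)) ≫ P1.str k

/-- The coordinate `t : B̂_n ⟶ ℙ¹`. -/
def Bhat.t (n : ℕ) : Bhat k n ⟶ P1 k := pullback.fst (P1.str k) (P1Pow.str k (n - 1))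

/-- The coordinates `y₁, …, y_{n-1} : B̂_n ⟶ ℙ¹` (indexed from `0` to `n - 2`). -/
def Bhat.y (n : ℕ) (i : Fin (n - 1)) : Bhat k n ⟶ P1 k :=
  pullback.snd (P1.str k) (P1Pow.str k (n - 1)) ≫
    WidePullback.π (fun _ : Fin (n - 1) => P1.str k) i

/-- `B_n = 𝔾ₘ × □^(n-1)`, as an open subset of `B̂_n`. -/
def B (n : ℕ) : (Bhat k n).Opens :=
  (Bhat.t k n ⁻¹ᵁ P1.Gm k) ⊓ Finset.univ.inf fun i => Bhat.y k n i ⁻¹ᵁ P1.square k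

/-- The Cartier divisor `F_{n,0} = {t = 0}` of `B̂_n`. -/
def F0 (n : ℕ) : (Bhat k n).IdealSheafData := (P1.zero k).comap (Bhat.t k n)

/-- The Cartier divisor `F¹_{n,i} = {y_i = 1}` of `B̂_n`. -/
def F1i (n : ℕ) (i : Fin (n - 1)) : (Bhat k n).IdealSheafData :=
  (P1.one k).comap (Bhat.y k n i)

/-- The Cartier divisor `F¹_n = ∑ F¹_{n,i}` of `B̂_n` (a product of ideal sheaves). -/
def F1 (n : ℕ) : (Bhat k n).IdealSheafData := ∏ i, F1i k n i

end Field

/-! ### Modulus conditions on subvarieties of `X × B_n` -/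

section Modulus

variable {k : Type u} [Field k] {X : Scheme.{u}} (f : X ⟶ Spec (.of k)) (n : ℕ)

/-- `X × B̂_n`, where `X` is a scheme over `k` with structure morphism `f`. -/
abbrev XBhat : Scheme.{u} := pullback f (Bhat.str k n)

/-- The projection `X × B̂_n ⟶ B̂_n`. -/
abbrev XBhat.proj : XBhat f n ⟶ Bhat k n := pullback.snd f (Bhat.str k n)

/-- `X × B_n`, as an open subset of `X × B̂_n`. -/
def XB : (XBhat f n).Opens := XBhat.proj f n ⁻¹ᵁ B k n

variable {f n}

/-- The closure in `X × B̂_n` of an integral closed subscheme `V` of `X × B_n`. Integral closed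
subschemes are given by their underlying irreducible closed subsets. -/
def closureHat (V : IrreducibleCloseds ↥(XB f n)) : Closeds (XBhat f n) :=
  Closeds.closure (Subtype.val '' (V : Set ↥(XB f n)))

theorem isIrreducible_closureHat (V : IrreducibleCloseds ↥(XB f n)) :
    IsIrreducible (closureHat V : Set (XBhat f n)) :=
  (V.isIrreducible.image _ continuous_subtype_val.continuousOn).closure

instance (V : IrreducibleCloseds ↥(XB f n)) : IsIntegral (reducedSubscheme (closureHat V)) :=
  isIntegral_reducedSubscheme _ (isIrreducible_closureHat V)

/-- The natural morphism `ν : V̄^N ⟶ X × B̂_n` from the normalization of the closure `V̄` of `V`. -/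
def nu (V : IrreducibleCloseds ↥(XB f n)) :
    normalization (reducedSubscheme (closureHat V)) ⟶ XBhat f n :=
  normalizationMap (reducedSubscheme (closureHat V)) ≫ reducedSubschemeι (closureHat V)

/-- The Weil divisor `[ν^* D]` on `V̄^N`, for a Cartier divisor `D` on `B̂_n`. -/
def pullbackDivisor (V : IrreducibleCloseds ↥(XB f n)) (D : (Bhat k n).IdealSheafData) :
    PrimeDivisor (normalization (reducedSubscheme (closureHat V))) → ℕ∞ :=
  weilDivisor ((D.comap (XBhat.proj f n)).comap (nu V))

/-- `V` satisfies the modulus `m` condition `M_sum`: `(m + 1) [ν^* F_{n,0}] ≤ [ν^* F¹_n]`. -/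
def ModulusSum (m : ℕ) (V : IrreducibleCloseds ↥(XB f n)) : Prop :=
  (m + 1) • pullbackDivisor V (F0 k n) ≤ pullbackDivisor V (F1 k n)

/-- `V` satisfies the modulus `m` condition `M_ssup`:
there is an `i` with `(m + 1) [ν^* F_{n,0}] ≤ [ν^* F¹_{n,i}]`. -/
def ModulusSSup (m : ℕ) (V : IrreducibleCloseds ↥(XB f n)) : Prop :=
  ∃ i, (m + 1) • pullbackDivisor V (F0 k n) ≤ pullbackDivisor V (F1i k n i)

end Modulus

/-- `W` is an irreducible component of the subset `Z` of the topological space `T`. -/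
def IsIrreducibleComponentOf {T : Type*} [TopologicalSpace T] (W Z : Set T) : Prop :=
  ∃ C ∈ irreducibleComponents ↥Z, Subtype.val '' C = W

end AdditiveChow

end

attribute [local instance] MvPolynomial.gradedAlgebra

namespace AdditiveChow

/-! ### Commutative algebra -/

/-! ### Integrality over a unique factorization domain, tested prime by prime -/

section UFD

/-! The component `V_Y` lies in `V`, and both modulus conditions pass to every integral closed
subset `W` of `V`. Locally on `X × B̂_n` the divisors `F_{n,0}` and `D` (one of `F¹_{n,i}`, `F¹_n`)
have equations `b` and `a`. On the normalization of the closure of `V`, the inequality of Weil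
divisors means that `b ^ (m + 1)` divides `a`, because a normal domain is determined in codimension
one. That divisibility amounts to an equation of integral dependence of `a` on the ideal generated
by `b ^ (m + 1)`, modulo the ideal of the closure of `V`. The equation has coefficients on the
ambient space, so it remains valid modulo the larger ideal of the closure of `W`. Reading it
backwards on the normalization of the closure of `W` gives the inequality there. This requires `b`
not to vanish identically on the closure of `W`, which holds because `W` is nonempty and `t` is
invertible on `X × B_n`.

The equivalence is `isIntegralModOver_ker_iff`, and the transfer is `weilDivisor_le_of_closeds_le`.
The algebraic core is `pow_dvd_of_finiteType`: divisibility in the normalization of a finitely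
generated domain can be tested at height one primes. It is proved without finiteness of the
normalization. Noether normalization supplies a polynomial ring `P` below, a Krull–Akizuki argument
makes the localizations at height one primes discrete valuation rings, and factorization in `P`
replaces primary decomposition upstairs. -/

theorem dvd_of_forall_prime_exists_dvd_mul {P : Type*} [CommRing P] [IsDomain P]
    [UniqueFactorizationMonoid P] {d e : P} (hd : d ≠ 0)
    (H : ∀ p : P, Prime p → ∃ s, ¬ p ∣ s ∧ d ∣ e * s) : d ∣ e := by
  obtain ⟨d', e', c, hrel, rfl, rfl⟩ := UniqueFactorizationMonoid.exists_reduced_factors d hd e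
  have hc : c ≠ 0 := left_ne_zero_of_mul hd
  have hd' : d' ≠ 0 := right_ne_zero_of_mul hd
  by_cases hu : IsUnit d'
  · exact mul_dvd_mul_left _ hu.dvd
  · obtain ⟨p, hp, hpd⟩ := WfDvdMonoid.exists_irreducible_factor hu hd'
    obtain ⟨s, hs, hds⟩ := H p hp.prime
    rw [mul_assoc, mul_dvd_mul_iff_left hc] at hds
    exact absurd (hpd.trans (hrel.dvd_of_dvd_mul_left hds)) hs

/-- `P` is integrally closed, so integrality of `h` can be read off the minimal polynomial of `d •
h`: its coefficient of degree `i` must be divisible by `d ^ (deg - i)`. Divisibility in a unique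
factorization domain is local at the primes. -/
theorem isIntegral_of_forall_prime {P K : Type*} [CommRing P] [IsDomain P]
    [UniqueFactorizationMonoid P] [Field K] [Algebra P K] [FaithfulSMul P K]
    {h : K} {d : P} (hd : d ≠ 0) (hdh : IsIntegral P (d • h))
    (H : ∀ p : P, Prime p → ∃ s : P, ¬ p ∣ s ∧ IsIntegral P (s • h)) : IsIntegral P h := by
  set f := minpoly P (d • h) with hf
  have key (i : ℕ) : d ^ (f.natDegree - i) ∣ f.coeff i := by
    refine dvd_of_forall_prime_exists_dvd_mul (pow_ne_zero _ hd) fun p hp => ?_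
    obtain ⟨s, hps, hs⟩ := H p hp
    have hs0 : s ≠ 0 := by rintro rfl; exact hps (dvd_zero _)
    -- The minimal polynomial of `s • d • h` is computed twice, by scaling that of `d • h` by `s`
    -- and that of `s • h` by `d`.
    have e1 := IsIntegrallyClosed.minpoly_smul hs0 hdh
    have e2 := IsIntegrallyClosed.minpoly_smul hd hs
    rw [smul_comm, e2] at e1
    refine ⟨s ^ (f.natDegree - i), fun h' => hps (hp.dvd_of_dvd_pow h'), ?_⟩
    have e3 := congrArg Polynomial.natDegree e1
    rw [Polynomial.natDegree_scaleRoots, Polynomial.natDegree_scaleRoots] at e3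
    have e4 := congrArg (fun q => Polynomial.coeff q i) e1
    simp only [Polynomial.coeff_scaleRoots] at e4
    rw [← hf] at e3 e4
    rw [← e4, e3]
    exact dvd_mul_left _ _
  choose g hg using key
  -- Dividing the coefficients by the powers of `d` undoes the scaling and leaves a monic polynomial
  -- that kills `h`.
  set q : Polynomial P := ∑ i ∈ Finset.range (f.natDegree + 1), Polynomial.monomial i (g i) with hq
  have hqc (i : ℕ) : q.coeff i = if i < f.natDegree + 1 then g i else 0 := by
    simp [hq, Polynomial.coeff_monomial]
  have hmon : f.Monic := minpoly.monic hdh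
  have hdeg : q.natDegree ≤ f.natDegree := by
    rw [Polynomial.natDegree_le_iff_coeff_eq_zero]
    intro N hN
    rw [hqc, if_neg (by omega)]
  have hlead : q.coeff f.natDegree = 1 := by
    have := hg f.natDegree
    rw [hqc, if_pos (by omega)]
    simpa [hmon.coeff_natDegree] using this.symm
  have hqm : q.Monic := Polynomial.monic_of_natDegree_le_of_coeff_eq_one _ hdeg hlead
  have hqd : q.natDegree = f.natDegree :=
    le_antisymm hdeg (Polynomial.le_natDegree_of_ne_zero (by simp [hlead]))
  have hqf : q.scaleRoots d = f := by
    ext i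
    rw [Polynomial.coeff_scaleRoots, hqd, hqc]
    split_ifs with hi
    · rw [hg i, mul_comm]
    · rw [zero_mul, Polynomial.coeff_eq_zero_of_natDegree_lt (by omega)]
  refine ⟨q, hqm, ?_⟩
  have e := Polynomial.scaleRoots_eval₂_mul (p := q) (algebraMap P K) h d
  rw [hqf, ← Algebra.smul_def, ← Polynomial.aeval_def, minpoly.aeval, eq_comm] at e
  exact (mul_eq_zero.mp e).resolve_left
    (pow_ne_zero _ (by simpa using hd))

end UFD

/-! ### A Krull–Akizuki finiteness argument -/

section KrullAkizuki

/-- Independence modulo `π` lifts: a relation can be divided by `π` indefinitely, so each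
coefficient is divisible by all powers of `π` and vanishes. -/
theorem linearIndependent_of_forall_prime_dvd {P M : Type*} [CommRing P] [IsDomain P]
    [WfDvdMonoid P] [AddCommGroup M] [Module P M] {π : P} (hπ : Prime π)
    (htf : ∀ m : M, π • m = 0 → m = 0) {ι : Type*} [Fintype ι] (x : ι → M)
    (hx : ∀ c : ι → P, ∀ y : M, ∑ i, c i • x i = π • y → ∀ i, π ∣ c i) :
    LinearIndependent P x := by
  rw [Fintype.linearIndependent_iff]
  have key (n : ℕ) : ∀ c : ι → P, ∑ i, c i • x i = 0 → ∀ i, π ^ n ∣ c i := by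
    induction n with
    | zero => intro c _ i; simp
    | succ n ih =>
      intro c hc
      choose c' hc' using hx c 0 (by simpa using hc)
      have : ∑ i, c' i • x i = 0 := by
        apply htf
        rw [← hc, Finset.smul_sum]
        exact Finset.sum_congr rfl fun i _ => by rw [hc' i, mul_smul]
      intro i
      rw [hc' i, pow_succ']
      exact mul_dvd_mul_left _ (ih c' this i)
  intro c hc i
  by_contra h0
  obtain ⟨n, hn⟩ := FiniteMultiplicity.of_not_isUnit hπ.not_isUnit h0
  exact hn (key _ c hc i)

/-- Families independent modulo `π` have bounded size, since they are independent over `P`. A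
largest such family in `I`, together with `π`, generates `I`: any further element enters a relation
whose leading coefficient is prime to `π`, hence a unit of `C`. -/
theorem fg_of_isUnit_algebraMap {P C : Type*} [CommRing P] [IsDomain P] [WfDvdMonoid P]
    [CommRing C] [IsDomain C] [Algebra P C] [FaithfulSMul P C] {π : P} (hπ : Prime π)
    (hunit : ∀ s, ¬ π ∣ s → IsUnit (algebraMap P C s)) {N : ℕ}
    (hN : ∀ r (x : Fin r → C), LinearIndependent P x → r ≤ N)
    (I : Ideal C) (hI : algebraMap P C π ∈ I) : I.FG := by
  classical
  let Q : ℕ → Prop := fun r => ∃ x : Fin r → C, (∀ i, x i ∈ I) ∧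
    ∀ c : Fin r → P, ∀ y : C, ∑ i, c i • x i = π • y → ∀ i, π ∣ c i
  have htf : ∀ m : C, π • m = 0 → m = 0 := fun m hm => by
    rw [Algebra.smul_def] at hm
    exact (mul_eq_zero.mp hm).resolve_left (by simpa using hπ.ne_zero)
  have hb : ∀ r, Q r → r ≤ N := fun r ⟨x, _, hx⟩ =>
    hN r x (linearIndependent_of_forall_prime_dvd hπ htf x hx)
  have h0 : Q 0 := ⟨Fin.elim0, fun i => i.elim0, fun _ _ _ i => i.elim0⟩
  obtain ⟨r, hr, ⟨x, hxI, hx⟩⟩ : ∃ r, r = Nat.findGreatest Q N ∧ Q r :=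
    ⟨_, rfl, Nat.findGreatest_spec (P := Q) (Nat.zero_le N) h0⟩
  have hnot : ¬ Q (r + 1) := fun h =>
    Nat.findGreatest_is_greatest (by omega) (hb _ h) h
  have hspan : I = Ideal.span (Set.range x ∪ {algebraMap P C π}) := by
    apply le_antisymm
    · intro z hz
      have : ∃ c : Fin (r + 1) → P, ∃ y : C,
          ∑ i, c i • (Fin.cons z x : Fin (r + 1) → C) i = π • y ∧ ∃ i, ¬ π ∣ c i := by
        by_contra! hcon
        exact hnot ⟨Fin.cons z x, fun i => Fin.cases hz hxI i, hcon⟩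
      obtain ⟨c, y, hcy, i, hi⟩ := this
      rw [Fin.sum_univ_succ] at hcy
      simp only [Fin.cons_zero, Fin.cons_succ] at hcy
      -- Otherwise the term in `z` is absorbed into the right-hand side, and independence of `x`
      -- makes every coefficient divisible by `π`.
      have hc0 : ¬ π ∣ c 0 := by
        rintro ⟨d, hd⟩
        have h' := hx (fun i => c i.succ) (y - d • z) (by
          rw [smul_sub, ← mul_smul, ← hd, ← hcy, add_sub_cancel_left])
        refine Fin.cases (motive := fun i => ¬ π ∣ c i → False) (fun h => h ⟨d, hd⟩)
          (fun j h => h (h' j)) i hi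
      obtain ⟨u, hu⟩ := hunit _ hc0
      have hz' : algebraMap P C (c 0) * z ∈ Ideal.span (Set.range x ∪ {algebraMap P C π}) := by
        have : algebraMap P C (c 0) * z =
            y * algebraMap P C π - ∑ i : Fin r, algebraMap P C (c i.succ) * x i := by
          simp only [Algebra.smul_def] at hcy
          linear_combination hcy
        rw [this]
        refine sub_mem (Ideal.mul_mem_left _ _ (Ideal.subset_span (by simp))) (sum_mem fun i _ => ?_)
        exact Ideal.mul_mem_left _ _ (Ideal.subset_span (Or.inl ⟨i, rfl⟩))
      rw [← hu] at hz'
      exact (Ideal.unit_mul_mem_iff_mem _ u.isUnit).mp hz'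
    · rw [Ideal.span_le]
      rintro _ (⟨i, rfl⟩ | rfl)
      · exact hxI i
      · exact hI
  rw [hspan]
  exact Submodule.fg_span ((Set.finite_range x).union (Set.finite_singleton _))

end KrullAkizuki

/-! ### Divisibility in a normal domain from height one primes -/

section Normal

/-- `C` is a normal local domain of dimension one, so only the Noetherian property is at stake. Its
one nonzero prime contains `π` and is finitely generated by the Krull–Akizuki argument. -/
theorem isDiscreteValuationRing_of_isLocalization_atPrime {P B K C : Type*} [CommRing P] [IsDomain P]
    [UniqueFactorizationMonoid P] [CommRing B] [IsDomain B] [IsIntegrallyClosed B]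
    [Algebra P B] [FaithfulSMul P B] [Field K] [Algebra B K] [IsFractionRing B K]
    [Algebra P K] [IsScalarTower P B K] {N : ℕ}
    (hN : ∀ r (x : Fin r → K), LinearIndependent P x → r ≤ N)
    (q : Ideal B) [q.IsPrime] (hq : q.height = 1) {π : P} (hπ : Prime π)
    (hqπ : q.comap (algebraMap P B) = Ideal.span {π})
    [CommRing C] [IsDomain C] [Algebra B C] [IsLocalization.AtPrime C q] :
    IsDiscreteValuationRing C := by
  have hqb : q ≠ ⊥ := q.ne_bot_of_height_eq_one hq
  have hle : q.primeCompl ≤ nonZeroDivisors B := q.primeCompl_le_nonZeroDivisors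
  have : IsLocalRing C := IsLocalization.AtPrime.isLocalRing C q
  have : IsIntegrallyClosed C := isIntegrallyClosed_of_isLocalization C q.primeCompl hle
  have hinj : Function.Injective (algebraMap B C) := IsLocalization.injective C hle
  let _ : Algebra P C := ((algebraMap B C).comp (algebraMap P B)).toAlgebra
  have : IsScalarTower P B C := .of_algebraMap_eq fun _ => rfl
  have hPC : Function.Injective (algebraMap P C) :=
    hinj.comp (FaithfulSMul.algebraMap_injective P B)
  have : FaithfulSMul P C := (faithfulSMul_iff_algebraMap_injective P C).mpr hPC
  have hunitK (y : q.primeCompl) : IsUnit (algebraMap B K y) :=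
    IsLocalization.map_units K (⟨y, hle y.2⟩ : nonZeroDivisors B)
  let φ : C →+* K := IsLocalization.lift (M := q.primeCompl) hunitK
  have hφ : Function.Injective φ := by
    rw [IsLocalization.lift_injective_iff]
    intro x y
    rw [hinj.eq_iff, (IsFractionRing.injective B K).eq_iff]
  have hφP (p : P) : φ (algebraMap P C p) = algebraMap P K p := by
    rw [IsScalarTower.algebraMap_apply P B C, IsLocalization.lift_eq,
      ← IsScalarTower.algebraMap_apply]
  let φₗ : C →ₗ[P] K :=
    { toFun := φ, map_add' := map_add φ,
      map_smul' := fun p c => by simp [Algebra.smul_def, hφP] }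
  have hNC : ∀ r (x : Fin r → C), LinearIndependent P x → r ≤ N := fun r x hx =>
    hN r (φₗ ∘ x) (hx.map' φₗ (LinearMap.ker_eq_bot.mpr hφ))
  have hdim : ringKrullDim C = 1 := by
    rw [IsLocalization.AtPrime.ringKrullDim_eq_height q C, hq]; rfl
  have hK1 : Ring.KrullDimLE 1 C := by
    rw [Ring.krullDimLE_iff, hdim]; rfl
  have hπq : algebraMap P B π ∈ q := by
    rw [← Ideal.mem_comap, hqπ]; exact Ideal.mem_span_singleton_self π
  have hmax (I : Ideal C) (hI : I.IsPrime) (hI0 : I ≠ ⊥) : I = IsLocalRing.maximalIdeal C :=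
    IsLocalRing.eq_maximalIdeal (hI.isMaximal_of_ne_bot hI0)
  have hπm : algebraMap P C π ∈ IsLocalRing.maximalIdeal C := by
    rw [IsScalarTower.algebraMap_apply P B C]
    exact (IsLocalization.AtPrime.to_map_mem_maximal_iff C q _).mpr hπq
  have : IsNoetherianRing C := by
    refine IsNoetherianRing.of_prime_ne_bot fun I hI hI0 => ?_
    rw [hmax I hI hI0]
    refine fg_of_isUnit_algebraMap hπ (fun s hs => ?_) hNC _ hπm
    rw [IsScalarTower.algebraMap_apply P B C]
    refine IsLocalization.map_units C (⟨algebraMap P B s, fun h => hs ?_⟩ : q.primeCompl)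
    rwa [← Ideal.mem_span_singleton, ← hqπ]
  have hnf : ¬ IsField C := fun hf => by
    rw [IsLocalRing.isField_iff_maximalIdeal_eq.mp hf, Ideal.mem_bot] at hπm
    exact hπ.ne_zero (hPC (by rw [hπm, map_zero]))
  refine (IsDiscreteValuationRing.TFAE C hnf |>.out 0 3 :
    IsDiscreteValuationRing C ↔ IsIntegrallyClosed C ∧ ∃! I : Ideal C, I ≠ ⊥ ∧ I.IsPrime).mpr
      ⟨inferInstance, IsLocalRing.maximalIdeal C, ⟨?_, inferInstance⟩,
        fun I hI => hmax I hI.2 hI.1⟩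
  intro h
  exact hnf (IsLocalRing.isField_iff_maximalIdeal_eq.mpr h)

/-- By incomparability, a nonzero prime strictly inside `q` would contract to a nonzero prime
strictly inside `(π)`. Such a contraction contains a prime element, necessarily associated to `π`.
-/
theorem height_eq_one_of_comap_eq_span {P B : Type*} [CommRing P] [IsDomain P]
    [UniqueFactorizationMonoid P] [CommRing B] [IsDomain B] [Algebra P B] [Algebra.IsIntegral P B]
    (q : Ideal B) [q.IsPrime] (hq0 : q ≠ ⊥) {π : P} (hπ : Prime π)
    (hqπ : q.comap (algebraMap P B) = Ideal.span {π}) : q.height = 1 := by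
  have hmin (q' : Ideal B) (hq' : q'.IsPrime) (hlt : q' < q) : q' = ⊥ := by
    by_contra h0
    have hlt : q'.comap (algebraMap P B) < q.comap (algebraMap P B) :=
      Ideal.IsIntegral.comap_lt_comap hlt
    have hne0 : q'.comap (algebraMap P B) ≠ ⊥ := Ideal.IsIntegral.comap_ne_bot _ h0
    have hp' : (q'.comap (algebraMap P B)).IsPrime := inferInstance
    obtain ⟨p, hpq, hp⟩ := hp'.exists_mem_prime_of_ne_bot hne0
    refine hlt.not_ge ?_
    rw [hqπ, Ideal.span_singleton_le_iff_mem]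
    have hπp : π ∣ p := by
      rw [← Ideal.mem_span_singleton, ← hqπ]; exact hlt.le hpq
    exact Ideal.mem_of_dvd _ (hπ.dvd_prime_iff_associated hp |>.mp hπp).symm.dvd hpq
  apply le_antisymm
  · rw [← Nat.cast_one, Ideal.height_le_iff]
    intro q' hq' hlt
    rw [hmin q' hq' hlt, Ideal.height_bot]
    exact_mod_cast one_pos
  · have := Ideal.height_add_one_le_of_lt_of_isPrime (bot_lt_iff_ne_bot.mpr hq0)
    rwa [Ideal.height_bot, zero_add] at this

/-- It suffices that `h = a / b ^ n` is integral over `P`. If this failed at a prime `π`, a prime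
`q` over `(π)` would contain all denominators of `h`. But `q` has height one, so `h` lies in the
valuation ring `B_q` and has a denominator outside `q`. -/
theorem pow_dvd_of_forall_height_eq_one {P B K : Type u} [CommRing P] [IsDomain P]
    [UniqueFactorizationMonoid P] [CommRing B] [IsDomain B] [IsIntegrallyClosed B]
    [Algebra P B] [FaithfulSMul P B] [Algebra.IsIntegral P B]
    [Field K] [Algebra B K] [IsFractionRing B K]
    [Algebra P K] [IsScalarTower P B K] {N : ℕ}
    (hN : ∀ r (x : Fin r → K), LinearIndependent P x → r ≤ N) {a b : B} (hb : b ≠ 0) {n : ℕ}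
    (H : ∀ q : Ideal B, q.IsPrime → q.height = 1 → ∃ (C : Type u) (_ : CommRing C)
      (_ : Algebra B C) (_ : q.IsPrime) (_ : IsLocalization.AtPrime C q),
      n • Ring.ord C (algebraMap B C b) ≤ Ring.ord C (algebraMap B C a)) : b ^ n ∣ a := by
  have hBK := IsFractionRing.injective B K
  have hPB := FaithfulSMul.algebraMap_injective P B
  have : FaithfulSMul P K := (faithfulSMul_iff_algebraMap_injective P K).mpr (by
    rw [IsScalarTower.algebraMap_eq P B K]; exact hBK.comp hPB)
  have hbn : b ^ n ≠ 0 := pow_ne_zero _ hb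
  have hbnK : algebraMap B K (b ^ n) ≠ 0 := by simpa using hbn
  let h : K := algebraMap B K a / algebraMap B K (b ^ n)
  have hh : algebraMap B K (b ^ n) * h = algebraMap B K a := mul_div_cancel₀ _ hbnK
  -- The ideal of denominators of `h`, consisting of the `s` with `s * h` in `B`.
  let D : Ideal B := Submodule.comap ((LinearMap.toSpanSingleton B K h)) (1 : Submodule B K)
  have hD (s : B) : s ∈ D ↔ ∃ y : B, algebraMap B K y = algebraMap B K s * h := by
    simp [D, Submodule.mem_one, Algebra.smul_def]
  have hbD : b ^ n ∈ D := (hD _).mpr ⟨a, hh.symm⟩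
  have hDP (s : P) (hs : algebraMap P B s ∈ D) : IsIntegral P (s • h) := by
    obtain ⟨y, hy⟩ := (hD _).mp hs
    rw [Algebra.smul_def, IsScalarTower.algebraMap_apply P B K, ← hy]
    exact (Algebra.IsIntegral.isIntegral (R := P) y).algebraMap
  have hDbot : D ≠ ⊥ := fun h0 => hbn (by rwa [h0, Ideal.mem_bot] at hbD)
  obtain ⟨d, hdD, hd0⟩ := Submodule.exists_mem_ne_zero_of_ne_bot
    (Ideal.IsIntegral.comap_ne_bot P hDbot)
  have hint : IsIntegral P h := by
    refine isIntegral_of_forall_prime hd0 (hDP d hdD) fun π hπ => ?_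
    by_contra! hcon
    have hprime : (Ideal.span {π}).IsPrime := (Ideal.span_singleton_prime hπ.ne_zero).mpr hπ
    have hdisj : Disjoint (D : Set B)
        ((Ideal.span {π}).primeCompl.map (algebraMap P B) : Set B) := by
      rw [Set.disjoint_left]
      rintro _ hsD ⟨s, hs, rfl⟩
      exact hcon s (fun h' => hs (Ideal.mem_span_singleton.mpr h')) (hDP s hsD)
    obtain ⟨q, hq, hDq, hqd⟩ := Ideal.exists_le_prime_disjoint _ _ hdisj
    have hq0 : q ≠ ⊥ := fun h0 => hDbot (le_bot_iff.mp (h0 ▸ hDq))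
    have hle : q.comap (algebraMap P B) ≤ Ideal.span {π} := by
      intro s hs
      by_contra hs'
      exact Set.disjoint_left.mp hqd hs ⟨s, hs', rfl⟩
    -- A nonzero prime of `P` inside `(π)` contains a prime element, which is then associated to
    -- `π`.
    have hqπ : q.comap (algebraMap P B) = Ideal.span {π} := by
      refine le_antisymm hle ?_
      obtain ⟨p, hpq, hp⟩ := (inferInstance :
        (q.comap (algebraMap P B)).IsPrime).exists_mem_prime_of_ne_bot
          (Ideal.IsIntegral.comap_ne_bot _ hq0)
      rw [Ideal.span_singleton_le_iff_mem]
      exact Ideal.mem_of_dvd _ (hπ.dvd_prime_iff_associated hp |>.mp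
        (Ideal.mem_span_singleton.mp (hle hpq))).symm.dvd hpq
    have hht := height_eq_one_of_comap_eq_span q hq0 hπ hqπ
    obtain ⟨C, _, _, _, _, hC⟩ := H q hq hht
    have hcompl : q.primeCompl ≤ nonZeroDivisors B := q.primeCompl_le_nonZeroDivisors
    have : IsDomain C := IsLocalization.isDomain_of_le_nonZeroDivisors C hcompl
    have := isDiscreteValuationRing_of_isLocalization_atPrime (C := C) hN q hht hπ hqπ
    rw [Ring.ord_eq_addVal, Ring.ord_eq_addVal, ← AddValuation.map_pow,
      IsDiscreteValuationRing.addVal_le_iff_dvd, ← map_pow] at hC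
    obtain ⟨c, hc⟩ := hC
    obtain ⟨⟨y, t⟩, hyt⟩ := IsLocalization.surj q.primeCompl c
    have heq : a * t = b ^ n * y := by
      have hinj : Function.Injective (algebraMap B C) := IsLocalization.injective C hcompl
      apply hinj
      rw [map_mul, map_mul, hc, mul_assoc]
      exact congrArg _ hyt
    refine t.2 (hDq ((hD _).mpr ⟨y, mul_left_cancel₀ hbnK ?_⟩))
    rw [mul_left_comm, hh, ← map_mul, ← map_mul, ← heq, mul_comm]
  obtain ⟨y, hy⟩ := (IsIntegrallyClosed.isIntegral_iff (R := B)).mp (hint.tower_top (A := B))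
  refine ⟨y, hBK ?_⟩
  rw [map_mul, hy, hh]

/-- A common denominator moves a finite family of `K` into the finite `P`-module `A` without
affecting independence. -/
theorem exists_card_bound_of_finite {P A K : Type*} [CommRing P] [IsDomain P] [CommRing A]
    [IsDomain A] [Algebra P A] [Module.Finite P A] [FaithfulSMul P A] [Field K] [Algebra A K]
    [IsFractionRing A K] [Algebra P K] [IsScalarTower P A K] :
    ∀ r (x : Fin r → K), LinearIndependent P x → r ≤ Module.finrank P A := by
  intro r x hx
  obtain ⟨d, hd⟩ := IsLocalization.exist_integer_multiples_of_finite (nonZeroDivisors A) x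
  choose y hy using hd
  have hdK : algebraMap A K d ≠ 0 := by
    simp [nonZeroDivisors.ne_zero d.2]
  let φ : K →ₗ[P] K := LinearMap.mulLeft P (algebraMap A K d)
  have hφ : Function.Injective φ := mul_right_injective₀ hdK
  have hy' : φ ∘ x = (IsScalarTower.toAlgHom P A K).toLinearMap ∘ y := by
    funext i
    simp [φ, hy, Algebra.smul_def]
  have h1 : LinearIndependent P (φ ∘ x) := hx.map' φ (LinearMap.ker_eq_bot.mpr hφ)
  rw [hy'] at h1
  simpa using (LinearIndependent.of_comp _ h1).fintype_card_le_finrank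

theorem isFractionRing_of_isIntegralClosure (A B K : Type*) [CommRing A] [IsDomain A] [CommRing B]
    [Algebra A B] [Field K] [Algebra A K] [IsFractionRing A K] [Algebra B K]
    [IsScalarTower A B K] [IsIntegralClosure B A K] : IsFractionRing B K := by
  have : FaithfulSMul B K := (faithfulSMul_iff_algebraMap_injective B K).mpr
    (IsIntegralClosure.algebraMap_injective B A K)
  refine IsFractionRing.of_field B K fun z => ?_
  obtain ⟨x, y, hy, rfl⟩ := IsFractionRing.div_surjective (A := A) z
  refine ⟨algebraMap A B x, algebraMap A B y, ?_⟩
  rw [← IsScalarTower.algebraMap_apply, ← IsScalarTower.algebraMap_apply]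

theorem isIntegrallyClosed_of_isIntegralClosure (A B K : Type*) [CommRing A] [IsDomain A]
    [CommRing B] [Algebra A B] [Field K] [Algebra A K] [IsFractionRing A K] [Algebra B K]
    [IsScalarTower A B K] [IsIntegralClosure B A K] : IsIntegrallyClosed B := by
  have := isFractionRing_of_isIntegralClosure A B K
  have : Algebra.IsIntegral A B := IsIntegralClosure.isIntegral_algebra A K
  rw [isIntegrallyClosed_iff K]
  intro x hx
  have : IsIntegral A x := isIntegral_trans (A := B) x hx
  exact IsIntegralClosure.isIntegral_iff.mp this

theorem pow_dvd_of_finiteType {k A B K : Type u} [Field k] [CommRing A] [IsDomain A]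
    [Algebra k A] [Algebra.FiniteType k A] [CommRing B] [Algebra A B] [Field K] [Algebra A K]
    [IsFractionRing A K] [Algebra B K] [IsScalarTower A B K] [IsIntegralClosure B A K]
    {a b : B} (hb : b ≠ 0) {n : ℕ}
    (H : ∀ q : Ideal B, q.IsPrime → q.height = 1 → ∃ (C : Type u) (_ : CommRing C)
      (_ : Algebra B C) (_ : q.IsPrime) (_ : IsLocalization.AtPrime C q),
      n • Ring.ord C (algebraMap B C b) ≤ Ring.ord C (algebraMap B C a)) : b ^ n ∣ a := by
  obtain ⟨s, g, hg, hgf⟩ := exists_finite_inj_algHom_of_fg k A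
  let P := MvPolynomial (Fin s) k
  let _ : Algebra P A := g.toRingHom.toAlgebra
  have : Module.Finite P A := hgf
  have : FaithfulSMul P A := (faithfulSMul_iff_algebraMap_injective P A).mpr hg
  let _ : Algebra P B := ((algebraMap A B).comp (algebraMap P A)).toAlgebra
  have : IsScalarTower P A B := .of_algebraMap_eq fun _ => rfl
  let _ : Algebra P K := ((algebraMap A K).comp (algebraMap P A)).toAlgebra
  have : IsScalarTower P A K := .of_algebraMap_eq fun _ => rfl
  have : IsScalarTower P B K := .of_algebraMap_eq fun p => by
    rw [IsScalarTower.algebraMap_apply P A K, IsScalarTower.algebraMap_apply P A B,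
      IsScalarTower.algebraMap_apply A B K]
  have hBK := IsIntegralClosure.algebraMap_injective B A K
  have hAB : Function.Injective (algebraMap A B) := by
    have := IsFractionRing.injective A K
    rw [IsScalarTower.algebraMap_eq A B K] at this
    exact Function.Injective.of_comp this
  have : FaithfulSMul P B := (faithfulSMul_iff_algebraMap_injective P B).mpr (hAB.comp hg)
  have : IsDomain B := hBK.isDomain (algebraMap B K)
  have : Algebra.IsIntegral A B := IsIntegralClosure.isIntegral_algebra A K
  have : Algebra.IsIntegral P B := Algebra.IsIntegral.trans A
  have := isFractionRing_of_isIntegralClosure A B K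
  have := isIntegrallyClosed_of_isIntegralClosure A B K
  exact pow_dvd_of_forall_height_eq_one (P := P) (K := K)
    (exists_card_bound_of_finite (P := P) (A := A)) hb H

end Normal

/-! ### Integral dependence modulo an ideal -/

section Dependence

/-- The element `a` satisfies, modulo `I`, an equation of integral dependence on the ideal
generated by `b`. -/
def IsIntegralModOver {R : Type*} [CommRing R] (I : Ideal R) (a b : R) : Prop :=
  ∃ (d : ℕ) (c : ℕ → R), a ^ d + ∑ i ∈ Finset.range d, c i * a ^ i * b ^ (d - i) ∈ I

theorem IsIntegralModOver.mono {R : Type*} [CommRing R] {I J : Ideal R} (hIJ : I ≤ J) {a b : R}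
    (h : IsIntegralModOver I a b) : IsIntegralModOver J a b := by
  obtain ⟨d, c, h⟩ := h
  exact ⟨d, c, hIJ h⟩

/-- Dividing the equation by `b ^ d` gives a monic equation for `a / b`, which normality places in
`B`. Conversely, a monic equation of the quotient over `R`, multiplied by `b ^ d`, has the required
shape. -/
theorem isIntegralModOver_ker_iff {R B : Type*} [CommRing R] [CommRing B] [IsDomain B]
    [IsIntegrallyClosed B] [Algebra R B] [Algebra.IsIntegral R B] {a b : R}
    (hb : algebraMap R B b ≠ 0) :
    IsIntegralModOver (RingHom.ker (algebraMap R B)) a b ↔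
      algebraMap R B b ∣ algebraMap R B a := by
  constructor
  · rintro ⟨d, c, h⟩
    rw [RingHom.mem_ker] at h
    have hbK : algebraMap R (FractionRing B) b ≠ 0 := by
      rw [IsScalarTower.algebraMap_apply R B (FractionRing B)]
      simpa using hb
    have hint : IsIntegral R (algebraMap R (FractionRing B) a / algebraMap R (FractionRing B) b) := by
      refine ⟨Polynomial.X ^ d + ∑ i ∈ Finset.range d, Polynomial.monomial i (c i), ?_, ?_⟩
      · refine Polynomial.monic_X_pow_add ?_
        refine (Polynomial.degree_sum_le _ _).trans_lt ?_
        rw [Finset.sup_lt_iff (WithBot.bot_lt_coe _)]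
        intro i hi
        exact (Polynomial.degree_monomial_le _ _).trans_lt
          (by exact_mod_cast Finset.mem_range.mp hi)
      · rw [Polynomial.eval₂_add, Polynomial.eval₂_finsetSum]
        simp only [Polynomial.eval₂_X_pow, Polynomial.eval₂_monomial]
        have h' := congrArg (algebraMap B (FractionRing B)) h
        rw [← IsScalarTower.algebraMap_apply] at h'
        simp only [map_add, map_pow, map_sum, map_mul, map_zero] at h'
        refine (mul_eq_zero.mp (?_ : algebraMap R (FractionRing B) b ^ d * _ = 0)).resolve_left
          (pow_ne_zero _ hbK)
        rw [← h', mul_add, Finset.mul_sum]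
        congr 1
        · rw [← mul_pow, mul_div_cancel₀ _ hbK]
        · refine Finset.sum_congr rfl fun i hi => ?_
          have : d = (d - i) + i := (Nat.sub_add_cancel (Finset.mem_range.mp hi).le).symm
          conv_lhs => rw [this, pow_add]
          rw [div_pow]
          have := pow_ne_zero i hbK
          field_simp
    obtain ⟨y, hy⟩ := (IsIntegrallyClosed.isIntegral_iff (R := B)).mp (hint.tower_top (A := B))
    refine ⟨y, IsFractionRing.injective B (FractionRing B) ?_⟩
    rw [map_mul, hy, ← IsScalarTower.algebraMap_apply, ← IsScalarTower.algebraMap_apply,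
      mul_div_cancel₀ (b := algebraMap R (FractionRing B) b) _ hbK]
  · rintro ⟨y, hy⟩
    obtain ⟨p, hp, hpy⟩ := Algebra.IsIntegral.isIntegral (R := R) y
    refine ⟨p.natDegree, p.coeff, ?_⟩
    rw [RingHom.mem_ker]
    simp only [map_add, map_pow, map_sum, map_mul, hy]
    rw [Polynomial.eval₂_eq_sum_range, Finset.sum_range_succ, hp.coeff_natDegree, map_one,
      one_mul] at hpy
    rw [← mul_zero (algebraMap R B b ^ p.natDegree), ← hpy, mul_add, Finset.mul_sum, add_comm,
      mul_pow]
    congr 1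
    refine Finset.sum_congr rfl fun i hi => ?_
    have : p.natDegree = (p.natDegree - i) + i :=
      (Nat.sub_add_cancel (Finset.mem_range.mp hi).le).symm
    conv_rhs => rw [this, pow_add]
    ring

theorem ord_pow_le_of_dvd {C : Type*} [CommRing C] [IsDomain C] {a b : C} (hb : b ≠ 0) {n : ℕ}
    (h : b ^ n ∣ a) : n • Ring.ord C b ≤ Ring.ord C a := by
  rw [← Ring.ord_pow (mem_nonZeroDivisors_of_ne_zero hb)]
  exact Ring.ord_le_ord_of_dvd h

end Dependence

/-! ### Inverse images of ideal sheaves -/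

section Comap

open Scheme

variable {X Y : Scheme.{u}}

/-- The whole space of an affine scheme, as an affine open. -/
abbrev topAffine (X : Scheme.{u}) [IsAffine X] : X.affineOpens := ⟨⊤, isAffineOpen_top X⟩

theorem ideal_comap_of_isAffine [IsAffine X] [IsAffine Y] (I : Y.IdealSheafData) (g : X ⟶ Y) :
    (I.comap g).ideal (topAffine X) = (I.ideal (topAffine Y)).map g.appTop.hom := by
  obtain ⟨J, hJ⟩ := (IdealSheafData.equivOfIsAffine (X := X)).surjective
    ((I.ideal (topAffine Y)).map g.appTop.hom)
  change J.ideal (topAffine X) = _ at hJ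
  apply le_antisymm
  · have h : I.comap g ≤ J := by
      rw [← IdealSheafData.le_map_iff_comap_le]
      apply IdealSheafData.le_of_isAffine
      rw [IdealSheafData.ideal_map _ _ _ (isAffineOpen_top X)]
      exact Ideal.map_le_iff_le_comap.mp hJ.ge
    exact (h _).trans hJ.le
  · rw [Ideal.map_le_iff_le_comap]
    have h : I ≤ (I.comap g).map g := IdealSheafData.le_map_iff_comap_le.mpr le_rfl
    refine (h _).trans ?_
    exact (IdealSheafData.ideal_map _ _ (topAffine Y) (isAffineOpen_top X)).le

theorem comap_inv_hom {R S : CommRingCat.{u}} (e : R ≅ S) (J : Ideal R) :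
    J.comap e.inv.hom = J.map e.hom.hom :=
  Ideal.comap_symm e.commRingCatIsoToRingEquiv

theorem ideal_comap_ι (I : X.IdealSheafData) (U : X.affineOpens) [IsAffine U.1.toScheme] :
    (I.comap U.1.ι).ideal (topAffine U.1.toScheme) =
      (I.ideal U).map (U.1.ι.appLE U.1 ⊤ (by simp)).hom := by
  rw [IdealSheafData.ideal_comap_of_isOpenImmersion, comap_inv_hom]
  have hle : U.1.ι ''ᵁ (topAffine U.1.toScheme).1 ≤ U.1 := by simp
  rw [← I.map_ideal (V := U) hle, Ideal.map_map, ← CommRingCat.hom_comp]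
  congr 2
  rw [Scheme.Hom.appIso_hom', Scheme.Hom.map_appLE]

/-- Restriction to `U` and `V` reduces this to affine schemes, where it follows from the adjunction
between `comap` and `map`. -/
theorem ideal_comap (I : Y.IdealSheafData) (f : X ⟶ Y) (U : X.affineOpens) (V : Y.affineOpens)
    (e : U.1 ≤ f ⁻¹ᵁ V.1) :
    (I.comap f).ideal U = (I.ideal V).map (f.appLE V.1 U.1 e).hom := by
  have : IsAffine U.1.toScheme := U.2
  have : IsAffine V.1.toScheme := V.2
  have h := ideal_comap_of_isAffine (I.comap V.1.ι) (f.resLE V.1 U.1 e)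
  have h' : f.appLE V.1 U.1 e ≫ U.1.ι.appLE U.1 ⊤ (by simp) =
      V.1.ι.appLE V.1 ⊤ (by simp) ≫ (f.resLE V.1 U.1 e).appTop := by
    have h1 : (f.resLE V.1 U.1 e).appTop = (f.resLE V.1 U.1 e).appLE ⊤ ⊤ le_rfl := by
      rw [Scheme.Hom.appTop, Scheme.Hom.app_eq_appLE]; rfl
    rw [h1]
    refine (Scheme.Hom.appLE_comp_appLE U.1.ι f _ _ _ _ _).trans
      (Eq.trans ?_ (Scheme.Hom.appLE_comp_appLE (f.resLE V.1 U.1 e) V.1.ι _ _ _ _ _).symm)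
    congr 1
    exact (Scheme.Hom.resLE_comp_ι f e).symm
  rw [← IdealSheafData.comap_comp, Scheme.Hom.resLE_comp_ι, IdealSheafData.comap_comp,
    ideal_comap_ι, ideal_comap_ι, Ideal.map_map, ← CommRingCat.hom_comp, ← h',
    CommRingCat.hom_comp, ← Ideal.map_map] at h
  let u := asIso (U.1.ι.appLE U.1 ⊤ U.1.ι_preimage_self.ge)
  have h2 := (comap_inv_hom u ((I.comap f).ideal U)).trans
    (h.trans (comap_inv_hom u ((I.ideal V).map (f.appLE V.1 U.1 e).hom)).symm)
  exact Ideal.comap_injective_of_surjective _ (ConcreteCategory.bijective_of_isIso u.inv).2 h2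

theorem stalkIdeal_eq (J : X.IdealSheafData) (U : X.affineOpens) {x : X} (hx : x ∈ U.1) :
    stalkIdeal J x = (J.ideal U).map (X.presheaf.germ U.1 x hx).hom := by
  apply le_antisymm
  · refine iSup₂_le fun V hV => ?_
    obtain ⟨_, ⟨W, hW, rfl⟩, hxW, hWle⟩ := X.isBasis_affineOpens.exists_subset_of_mem_open
      (show x ∈ ((V.1 ⊓ U.1 : X.Opens) : Set X) from ⟨hV, hx⟩) (V.1 ⊓ U.1).isOpen
    have h (V' : X.affineOpens) (hV' : x ∈ V'.1) (hle : W ≤ V'.1) :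
        (J.ideal V').map (X.presheaf.germ V'.1 x hV').hom =
          (J.ideal ⟨W, hW⟩).map (X.presheaf.germ W x hxW).hom := by
      rw [← J.map_ideal (U := ⟨W, hW⟩) (V := V') hle, Ideal.map_map, ← CommRingCat.hom_comp]
      exact congrArg (fun φ => Ideal.map (CommRingCat.Hom.hom φ) (J.ideal V'))
        (X.presheaf.germ_res (homOfLE hle) x hxW).symm
    rw [h V hV fun y hy => (hWle hy).1, h U hx fun y hy => (hWle hy).2]
  · exact le_iSup₂_of_le U hx le_rfl

/-- An ideal sheaf that is locally generated by one section. -/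
def IsLocallyPrincipal (J : X.IdealSheafData) : Prop :=
  ∀ x : X, ∃ U : X.affineOpens, x ∈ U.1 ∧ (J.ideal U).IsPrincipal

theorem isPrincipal_ideal_of_le {J : X.IdealSheafData} {U V : X.affineOpens} (h : U ≤ V)
    (hV : (J.ideal V).IsPrincipal) : (J.ideal U).IsPrincipal := by
  rw [← J.map_ideal h]
  obtain ⟨a, ha⟩ := hV
  rw [ha]
  exact ⟨⟨_, by rw [Ideal.submodule_span_eq, Ideal.map_span, Set.image_singleton]⟩⟩

theorem exists_affineOpens_mem_le {x : X} {W : X.Opens} (hx : x ∈ W) :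
    ∃ U : X.affineOpens, x ∈ U.1 ∧ U.1 ≤ W := by
  obtain ⟨_, ⟨U, hU, rfl⟩, hxU, hle⟩ := X.isBasis_affineOpens.exists_subset_of_mem_open
    (show x ∈ (W : Set X) from hx) W.isOpen
  exact ⟨⟨U, hU⟩, hxU, hle⟩

theorem IsLocallyPrincipal.comap {J : Y.IdealSheafData} (hJ : IsLocallyPrincipal J) (f : X ⟶ Y) :
    IsLocallyPrincipal (J.comap f) := by
  intro x
  obtain ⟨V, hxV, ⟨a, ha⟩⟩ := hJ (f x)
  obtain ⟨U, hxU, hle⟩ := exists_affineOpens_mem_le (W := f ⁻¹ᵁ V.1) hxV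
  refine ⟨U, hxU, ?_⟩
  rw [ideal_comap J f U V hle, ha]
  exact ⟨⟨_, by rw [Ideal.submodule_span_eq, Ideal.map_span, Set.image_singleton]⟩⟩

theorem IsLocallyPrincipal.exists_le {J : X.IdealSheafData} (hJ : IsLocallyPrincipal J) {x : X}
    {W : X.Opens} (hx : x ∈ W) :
    ∃ U : X.affineOpens, x ∈ U.1 ∧ U.1 ≤ W ∧ (J.ideal U).IsPrincipal := by
  obtain ⟨V, hxV, hV⟩ := hJ x
  obtain ⟨U, hxU, hle⟩ := exists_affineOpens_mem_le (W := V.1 ⊓ W) ⟨hxV, hx⟩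
  exact ⟨U, hxU, hle.trans inf_le_right, isPrincipal_ideal_of_le (hle.trans inf_le_left) hV⟩

theorem IsLocallyPrincipal.mul {I J : X.IdealSheafData} (hI : IsLocallyPrincipal I)
    (hJ : IsLocallyPrincipal J) : IsLocallyPrincipal (I * J) := by
  intro x
  obtain ⟨V, hxV, hV⟩ := hI x
  obtain ⟨U, hxU, hle, ⟨b, hb⟩⟩ := hJ.exists_le hxV
  obtain ⟨a, ha⟩ := isPrincipal_ideal_of_le (U := U) hle hV
  refine ⟨U, hxU, ⟨a * b, ?_⟩⟩
  rw [IdealSheafData.ideal_mul, Pi.mul_apply, ha, hb, Ideal.submodule_span_eq,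
    Ideal.submodule_span_eq, Ideal.submodule_span_eq, Ideal.span_singleton_mul_span_singleton]

theorem isLocallyPrincipal_top : IsLocallyPrincipal (⊤ : X.IdealSheafData) := by
  intro x
  obtain ⟨U, hxU, -⟩ := exists_affineOpens_mem_le (x := x) (W := ⊤) trivial
  exact ⟨U, hxU, ⟨1, by simp⟩⟩

theorem isLocallyPrincipal_prod {ι : Type*} (s : Finset ι) (J : ι → X.IdealSheafData)
    (h : ∀ i ∈ s, IsLocallyPrincipal (J i)) : IsLocallyPrincipal (∏ i ∈ s, J i) :=
  Finset.prod_induction _ _ (fun _ _ => .mul) isLocallyPrincipal_top h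

end Comap

/-! ### The normalization of an integral scheme -/

section Normalization

theorem isIntegralClosure_of_equiv {A B K K' : Type*} [CommRing A] [CommRing B] [CommRing K]
    [CommRing K'] [Algebra A B] [Algebra A K] [Algebra A K'] [Algebra B K]
    (β : B ≃+* integralClosure A K') (e : K ≃ₐ[A] K')
    (h : ∀ b, e (algebraMap B K b) = β b) : IsIntegralClosure B A K where
  algebraMap_injective := fun b b' hbb' => by
    apply β.injective
    apply Subtype.ext
    rw [← h, ← h, hbb']
  isIntegral_iff := fun {x} => by
    rw [← isIntegral_algEquiv e]
    constructor
    · intro hx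
      refine ⟨β.symm ⟨e x, hx⟩, e.injective ?_⟩
      rw [h, RingEquiv.apply_symm_apply]
    · rintro ⟨y, rfl⟩
      rw [h]
      exact (β y).2

variable (T : Scheme.{u}) [IsIntegral T]

instance : IsIntegral (normalization T) := by
  unfold normalization; infer_instance

instance : IsIntegralHom (normalizationMap T) := by
  exact inferInstanceAs (IsIntegralHom (genericPointι T).fromNormalization)

theorem ker_genericPointι : (genericPointι T).ker = ⊥ := by
  rw [← Scheme.IdealSheafData.support_eq_top_iff]
  ext1
  rw [Scheme.Hom.support_ker]
  have h : genericPoint T ∈ Set.range (genericPointι T) := by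
    rw [Scheme.range_fromSpecStalk]
    exact specializes_rfl
  refine Set.eq_univ_of_univ_subset ?_
  rw [← (genericPoint_spec T).def]
  exact closure_mono (Set.singleton_subset_iff.mpr h)

theorem ker_normalizationMap : (normalizationMap T).ker = ⊥ := by
  rw [eq_bot_iff, ← ker_genericPointι T]
  have h := Scheme.Hom.toNormalization_fromNormalization (genericPointι T)
  conv_rhs => rw [← h]
  exact Scheme.Hom.le_ker_comp _ _

/-- Relative normalization takes the integral closure in the sections of `Spec` of the function
field over the preimage of `U`. As `U` contains the generic point, that preimage is everything and
the sections are the function field. -/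
theorem isIntegralClosure_normalization (U : T.affineOpens) (hU : genericPoint T ∈ U.1) :
    ∃ (_ : Algebra Γ(normalization T, normalizationMap T ⁻¹ᵁ U.1) T.functionField)
      (_ : Algebra Γ(T, U.1) T.functionField),
      let _ : Algebra Γ(T, U.1) Γ(normalization T, normalizationMap T ⁻¹ᵁ U.1) :=
        ((normalizationMap T).app U.1).hom.toAlgebra
      IsFractionRing Γ(T, U.1) T.functionField ∧
      IsScalarTower Γ(T, U.1) Γ(normalization T, normalizationMap T ⁻¹ᵁ U.1) T.functionField ∧
      IsIntegralClosure Γ(normalization T, normalizationMap T ⁻¹ᵁ U.1) Γ(T, U.1)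
        T.functionField := by
  let ι := genericPointι T
  let _ : Algebra Γ(T, U.1) Γ(Spec T.functionField, ι ⁻¹ᵁ U.1) := (ι.app U.1).hom.toAlgebra
  let _ : Algebra Γ(T, U.1) T.functionField :=
    (T.presheaf.germ U.1 (genericPoint T) hU).hom.toAlgebra
  have htop : (⊤ : (Spec T.functionField).Opens) = ι ⁻¹ᵁ U.1 := by
    refine (eq_top_iff.mpr fun x _ => ?_).symm
    have : Subsingleton (Spec T.functionField) :=
      inferInstanceAs (Subsingleton (PrimeSpectrum T.functionField))
    have h : genericPoint T ∈ Set.range ι := by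
      rw [Scheme.range_fromSpecStalk]
      exact specializes_rfl
    obtain ⟨y, hy⟩ := h
    change ι x ∈ U.1
    rw [Subsingleton.elim x y, hy]
    exact hU
  let e₀ : T.functionField ≅ Γ(Spec T.functionField, ι ⁻¹ᵁ U.1) :=
    (Scheme.ΓSpecIso T.functionField).symm ≪≫
      (Spec T.functionField).presheaf.mapIso (eqToIso htop.symm).op
  have he₀ : T.presheaf.germ U.1 (genericPoint T) hU ≫ e₀.hom = ι.app U.1 :=
    (Scheme.fromSpecStalk_app hU).symm
  let e : T.functionField ≃ₐ[Γ(T, U.1)] Γ(Spec T.functionField, ι ⁻¹ᵁ U.1) :=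
    AlgEquiv.ofRingEquiv (f := e₀.commRingCatIsoToRingEquiv) fun x =>
      congrArg (fun φ => φ.hom x) he₀
  let β := (ι.normalizationObjIso U.2).commRingCatIsoToRingEquiv
  let _ : Algebra Γ(T, U.1) Γ(normalization T, normalizationMap T ⁻¹ᵁ U.1) :=
    ((normalizationMap T).app U.1).hom.toAlgebra
  let _ : Algebra Γ(normalization T, normalizationMap T ⁻¹ᵁ U.1) T.functionField :=
    (e.symm.toRingEquiv.toRingHom.comp ((integralClosure Γ(T, U.1)
      Γ(Spec T.functionField, ι ⁻¹ᵁ U.1)).val.toRingHom.comp β.toRingHom)).toAlgebra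
  have hcl : IsIntegralClosure Γ(normalization T, normalizationMap T ⁻¹ᵁ U.1) Γ(T, U.1)
        T.functionField := isIntegralClosure_of_equiv β e fun b => e.apply_symm_apply _
  have : Nonempty U.1 := ⟨⟨_, hU⟩⟩
  refine ⟨inferInstance, inferInstance, functionField_isFractionRing_of_isAffineOpen T U.1 U.2,
    .of_algebraMap_eq fun x => e.injective ?_, hcl⟩
  rw [e.commutes]
  have h1 := congrArg (fun φ => φ.hom x) (ι.fromNormalization_app U.2)
  change _ = e (e.symm (β (ι.fromNormalization.app U.1 x)).1)
  rw [e.apply_symm_apply]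
  refine congrArg Subtype.val (a₁ := algebraMap Γ(T, U.1) (integralClosure Γ(T, U.1)
      Γ(Spec T.functionField, ι ⁻¹ᵁ U.1)) x) ?_
  rw [← RingEquiv.symm_apply_eq]
  exact h1.symm

variable {T}

/-- This turns height one primes of an affine open into prime divisors, with stalks as
localizations. -/
theorem exists_isLocalization_stalk {N : Scheme.{u}} {V : N.Opens} (hV : IsAffineOpen V)
    (q : Ideal Γ(N, V)) [hq : q.IsPrime] :
    ∃ (x : N) (hx : x ∈ V), Order.coheight x = q.height ∧
      let _ : Algebra Γ(N, V) (N.presheaf.stalk x) := (N.presheaf.germ V x hx).hom.toAlgebra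
      IsLocalization.AtPrime (N.presheaf.stalk x) q := by
  let y : PrimeSpectrum Γ(N, V) := ⟨q, hq⟩
  have hy : hV.fromSpec y ∈ V := by
    rw [← SetLike.mem_coe, ← hV.range_fromSpec]
    exact ⟨y, rfl⟩
  refine ⟨hV.fromSpec y, hy, ?_, hV.isLocalization_stalk' y hy⟩
  let _ : Algebra Γ(N, V) (N.presheaf.stalk (hV.fromSpec y)) :=
    TopCat.Presheaf.algebra_section_stalk N.presheaf ⟨hV.fromSpec y, hy⟩
  have : IsLocalization.AtPrime (N.presheaf.stalk (hV.fromSpec y)) q :=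
    hV.isLocalization_stalk' y hy
  have h := ringKrullDim_stalk_eq_coheight (hV.fromSpec y)
  rw [IsLocalization.AtPrime.ringKrullDim_eq_height q] at h
  exact_mod_cast h.symm

theorem pow_dvd_of_forall_coheight_eq_one {k : Type u} [Field k] (g : T ⟶ Spec (.of k))
    [LocallyOfFiniteType g] (U : T.affineOpens) (hU : genericPoint T ∈ U.1)
    {a b : Γ(normalization T, normalizationMap T ⁻¹ᵁ U.1)} (hb : b ≠ 0) {n : ℕ}
    (H : ∀ (x : normalization T) (hx : x ∈ normalizationMap T ⁻¹ᵁ U.1), Order.coheight x = 1 →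
      n • Ring.ord ((normalization T).presheaf.stalk x)
        ((normalization T).presheaf.germ (normalizationMap T ⁻¹ᵁ U.1) x hx b) ≤
      Ring.ord ((normalization T).presheaf.stalk x)
        ((normalization T).presheaf.germ (normalizationMap T ⁻¹ᵁ U.1) x hx a)) : b ^ n ∣ a := by
  let _ : Algebra Γ(T, U.1) Γ(normalization T, normalizationMap T ⁻¹ᵁ U.1) :=
    ((normalizationMap T).app U.1).hom.toAlgebra
  obtain ⟨_, _, _, _, _⟩ := isIntegralClosure_normalization T U hU
  have : Nonempty U.1 := ⟨⟨_, hU⟩⟩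
  let φ : k →+* Γ(T, U.1) := (g.appLE ⊤ U.1 le_top).hom.comp (Scheme.ΓSpecIso (.of k)).inv.hom
  let _ : Algebra k Γ(T, U.1) := φ.toAlgebra
  have hφ : φ.FiniteType := by
    refine RingHom.FiniteType.comp ?_ (RingHom.FiniteType.of_surjective _
      (ConcreteCategory.bijective_of_isIso (Scheme.ΓSpecIso (.of k)).inv).2)
    exact LocallyOfFiniteType.finiteType_appLE g (isAffineOpen_top _) U.2 le_top
  have : Algebra.FiniteType k Γ(T, U.1) := hφ
  have hV : IsAffineOpen (normalizationMap T ⁻¹ᵁ U.1) := U.2.preimage _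
  refine pow_dvd_of_finiteType (k := k) (A := Γ(T, U.1)) (K := T.functionField) hb fun q hq hq1 => ?_
  obtain ⟨x, hx, hcoh, hloc⟩ := exists_isLocalization_stalk hV q
  exact ⟨_, inferInstance, ((normalization T).presheaf.germ _ x hx).hom.toAlgebra, hq, hloc,
    H x hx (hcoh.trans hq1)⟩

theorem isIntegrallyClosed_normalization (U : T.affineOpens) (hU : genericPoint T ∈ U.1) :
    IsIntegrallyClosed Γ(normalization T, normalizationMap T ⁻¹ᵁ U.1) := by
  let _ : Algebra Γ(T, U.1) Γ(normalization T, normalizationMap T ⁻¹ᵁ U.1) :=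
    ((normalizationMap T).app U.1).hom.toAlgebra
  obtain ⟨_, _, _, _, _⟩ := isIntegralClosure_normalization T U hU
  have : Nonempty U.1 := ⟨⟨_, hU⟩⟩
  exact isIntegrallyClosed_of_isIntegralClosure Γ(T, U.1) _ T.functionField

end Normalization

/-! ### Divisors on the normalization of a closed subscheme -/

section Containment

open Scheme

variable {S : Scheme.{u}}

theorem weilDivisor_comap {N : Scheme.{u}} (h : N ⟶ S) [IsAffineHom h] {I : S.IdealSheafData}
    {U : S.affineOpens} {b : Γ(S, U.1)} (hb : I.ideal U = Ideal.span {b}) (x : PrimeDivisor N)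
    (hx : x.1 ∈ h ⁻¹ᵁ U.1) :
    weilDivisor (I.comap h) x =
      Ring.ord (N.presheaf.stalk x.1) (N.presheaf.germ (h ⁻¹ᵁ U.1) x.1 hx (h.app U.1 b)) := by
  have h1 : stalkIdeal (I.comap h) x.1 =
      Ideal.span {N.presheaf.germ (h ⁻¹ᵁ U.1) x.1 hx (h.app U.1 b)} := by
    rw [stalkIdeal_eq _ ⟨h ⁻¹ᵁ U.1, U.2.preimage h⟩ hx, ideal_comap I h _ U le_rfl, hb,
      Ideal.map_map, Ideal.map_span, Set.image_singleton, ← Scheme.Hom.app_eq_appLE]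
    rfl
  rw [weilDivisor, Ring.ord, h1]

/-- The morphism to `S` from the normalization of an integral closed subscheme. -/
noncomputable abbrev normalizationι (Z : Closeds S) [IsIntegral (reducedSubscheme Z)] :
    normalization (reducedSubscheme Z) ⟶ S :=
  normalizationMap (reducedSubscheme Z) ≫ reducedSubschemeι Z

variable (Z : Closeds S) [IsIntegral (reducedSubscheme Z)]

theorem nonempty_of_ne {U : S.Opens} {s t : Γ(S, U)} (h : s ≠ t) : Nonempty U := by
  by_contra hU
  have hbot : U = ⊥ := by
    ext x
    exact ⟨fun hx => (hU ⟨⟨x, hx⟩⟩).elim, fun hx => hx.elim⟩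
  subst hbot
  exact h (Subsingleton.elim _ _)

theorem coe_reducedSubschemeι_mem (Z : Closeds S) (x : reducedSubscheme Z) :
    reducedSubschemeι Z x ∈ (Z : Set S) := by
  have h : reducedSubschemeι Z x ∈ Set.range (reducedSubschemeι Z) := ⟨x, rfl⟩
  rwa [IdealSheafData.range_subschemeι, IdealSheafData.coe_support_vanishingIdeal] at h

theorem ker_normalizationι : (normalizationι Z).ker = IdealSheafData.vanishingIdeal Z := by
  rw [← IdealSheafData.map_ker, ker_normalizationMap, IdealSheafData.map_bot,
    IdealSheafData.ker_subschemeι]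

variable {Z}

/-- If `b` vanished, `I.support` would contain `Z` over `U`. By irreducibility, `U` and the
complement of `I.support` meet inside `Z`. -/
theorem normalizationι_app_ne_zero (hZ : IsIrreducible (Z : Set S)) {I : S.IdealSheafData}
    (hI : ¬ (Z : Set S) ⊆ I.support) {U : S.affineOpens}
    (hU : genericPoint (reducedSubscheme Z) ∈ reducedSubschemeι Z ⁻¹ᵁ U.1) {b : Γ(S, U.1)}
    (hb : I.ideal U = Ideal.span {b}) : (normalizationι Z).app U.1 b ≠ 0 := by
  intro h0
  have hbZ : I.ideal U ≤ (IdealSheafData.vanishingIdeal Z).ideal U := by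
    rw [hb, Ideal.span_singleton_le_iff_mem, ← ker_normalizationι, Hom.ker_apply]
    exact h0
  obtain ⟨y, hyZ, hyI⟩ := Set.not_subset.mp hI
  have hgZ : reducedSubschemeι Z (genericPoint (reducedSubscheme Z)) ∈ (Z : Set S) :=
    coe_reducedSubschemeι_mem Z _
  obtain ⟨z, hzZ, hzU, hzI⟩ := hZ.2 U.1 ((I.support : Set S)ᶜ) U.1.isOpen
    I.support.isClosed.isOpen_compl ⟨_, hgZ, hU⟩ ⟨y, hyZ, hyI⟩
  apply hzI
  have hz : z ∈ (IdealSheafData.vanishingIdeal Z).support := by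
    rwa [← SetLike.mem_coe, IdealSheafData.coe_support_vanishingIdeal]
  exact (IdealSheafData.mem_support_iff_of_mem hzU).mpr
    (Scheme.zeroLocus_mono S (fun _ h => hbZ h) ((IdealSheafData.mem_support_iff_of_mem hzU).mp hz))

/-- The bridge between the two sides: the left lives on `S` and depends on `Z` only through its
ideal, the kernel of restriction to the normalization. -/
theorem isIntegralModOver_vanishingIdeal_iff (hZ : IsIrreducible (Z : Set S))
    {I : S.IdealSheafData} (hI : ¬ (Z : Set S) ⊆ I.support) {U : S.affineOpens}
    (hU : genericPoint (reducedSubscheme Z) ∈ reducedSubschemeι Z ⁻¹ᵁ U.1) {a b : Γ(S, U.1)}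
    (hb : I.ideal U = Ideal.span {b}) (n : ℕ) :
    IsIntegralModOver ((IdealSheafData.vanishingIdeal Z).ideal U) a (b ^ n) ↔
      (normalizationι Z).app U.1 b ^ n ∣ (normalizationι Z).app U.1 a := by
  have hb0 := normalizationι_app_ne_zero hZ hI hU hb
  let _ : Algebra Γ(S, U.1) Γ(normalization (reducedSubscheme Z), normalizationι Z ⁻¹ᵁ U.1) :=
    ((normalizationι Z).app U.1).hom.toAlgebra
  have : Algebra.IsIntegral Γ(S, U.1)
      Γ(normalization (reducedSubscheme Z), normalizationι Z ⁻¹ᵁ U.1) :=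
    algebraMap_isIntegral_iff.mp (IsIntegralHom.isIntegral_app (normalizationι Z) U.1 U.2)
  let U' : (reducedSubscheme Z).affineOpens :=
    ⟨reducedSubschemeι Z ⁻¹ᵁ U.1, U.2.preimage (reducedSubschemeι Z)⟩
  have : IsIntegrallyClosed Γ(normalization (reducedSubscheme Z), normalizationι Z ⁻¹ᵁ U.1) :=
    isIntegrallyClosed_normalization U' hU
  have : Nonempty (normalizationι Z ⁻¹ᵁ U.1) := nonempty_of_ne hb0
  have : IsDomain Γ(normalization (reducedSubscheme Z), normalizationι Z ⁻¹ᵁ U.1) :=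
    inferInstance
  rw [← ker_normalizationι, Hom.ker_apply]
  refine (isIntegralModOver_ker_iff (R := Γ(S, U.1))
    (B := Γ(normalization (reducedSubscheme Z), normalizationι Z ⁻¹ᵁ U.1)) ?_).trans ?_
  · rw [map_pow]
    exact pow_ne_zero _ hb0
  · rw [map_pow]; rfl

theorem isIntegralModOver_of_weilDivisor_le {k : Type u} [Field k] (g : S ⟶ Spec (.of k))
    [LocallyOfFiniteType g] (hZ : IsIrreducible (Z : Set S))
    {I J : S.IdealSheafData} (hI : ¬ (Z : Set S) ⊆ I.support) {n : ℕ}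
    (H : n • weilDivisor (I.comap (normalizationι Z)) ≤ weilDivisor (J.comap (normalizationι Z)))
    {U : S.affineOpens} {a b : Γ(S, U.1)}
    (ha : J.ideal U = Ideal.span {a}) (hb : I.ideal U = Ideal.span {b}) :
    IsIntegralModOver ((IdealSheafData.vanishingIdeal Z).ideal U) a (b ^ n) := by
  by_cases hU : genericPoint (reducedSubscheme Z) ∈ reducedSubschemeι Z ⁻¹ᵁ U.1
  · rw [isIntegralModOver_vanishingIdeal_iff hZ hI hU hb]
    let U' : (reducedSubscheme Z).affineOpens :=
      ⟨reducedSubschemeι Z ⁻¹ᵁ U.1, U.2.preimage (reducedSubschemeι Z)⟩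
    refine pow_dvd_of_forall_coheight_eq_one (reducedSubschemeι Z ≫ g) U' hU
      (a := (normalizationι Z).app U.1 a) (b := (normalizationι Z).app U.1 b)
      (normalizationι_app_ne_zero hZ hI hU hb) fun x (hx : x ∈ normalizationι Z ⁻¹ᵁ U.1) hx1 => ?_
    have h := H ⟨x, hx1⟩
    rw [Pi.smul_apply, weilDivisor_comap (normalizationι Z) hb ⟨x, hx1⟩ hx,
      weilDivisor_comap (normalizationι Z) ha ⟨x, hx1⟩ hx] at h
    exact h
  · have : (IdealSheafData.vanishingIdeal Z).ideal U = ⊤ := by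
      rw [← ker_normalizationι, Hom.ker_apply, Ideal.eq_top_iff_one, RingHom.mem_ker]
      by_contra h
      obtain ⟨x, hx⟩ := nonempty_of_ne h
      exact hU ((genericPoint_specializes (normalizationMap _ x)).mem_open
        (reducedSubschemeι Z ⁻¹ᵁ U.1).isOpen hx)
    -- Here `Z` misses `U`, and the equation of degree `0` says that `1` lies in the unit ideal.
    exact ⟨0, fun _ => 0, this ▸ trivial⟩

/-- The equation of dependence modulo the ideal of `Z` also holds modulo the larger ideal of `W`. -/
theorem weilDivisor_le_of_closeds_le {k : Type u} [Field k] (g : S ⟶ Spec (.of k))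
    [LocallyOfFiniteType g] (hZ : IsIrreducible (Z : Set S)) {W : Closeds S}
    [IsIntegral (reducedSubscheme W)] (hW : IsIrreducible (W : Set S)) (hWZ : W ≤ Z)
    {I J : S.IdealSheafData} (hI : IsLocallyPrincipal I) (hJ : IsLocallyPrincipal J)
    (hWI : ¬ (W : Set S) ⊆ I.support) {n : ℕ}
    (H : n • weilDivisor (I.comap (normalizationι Z)) ≤ weilDivisor (J.comap (normalizationι Z))) :
    n • weilDivisor (I.comap (normalizationι W)) ≤ weilDivisor (J.comap (normalizationι W)) := by
  intro x
  obtain ⟨V, hxV, hV⟩ := hI (normalizationι W x.1)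
  obtain ⟨U, hxU, hle, ⟨a, ha⟩⟩ := hJ.exists_le hxV
  obtain ⟨b, hb⟩ := isPrincipal_ideal_of_le (U := U) hle hV
  have hZI : ¬ (Z : Set S) ⊆ I.support := fun h => hWI (subset_trans hWZ h)
  have hint := (isIntegralModOver_of_weilDivisor_le g hZ hZI H ha hb).mono
    (IdealSheafData.vanishingIdeal_antimono hWZ U)
  have hU : genericPoint (reducedSubscheme W) ∈ reducedSubschemeι W ⁻¹ᵁ U.1 :=
    (genericPoint_specializes (normalizationMap _ x.1)).mem_open
      (reducedSubschemeι W ⁻¹ᵁ U.1).isOpen hxU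
  rw [isIntegralModOver_vanishingIdeal_iff hW hWI hU hb] at hint
  rw [Pi.smul_apply, weilDivisor_comap (normalizationι W) hb x hxU,
    weilDivisor_comap (normalizationι W) ha x hxU]
  have : Nonempty (normalizationι W ⁻¹ᵁ U.1) := ⟨⟨x.1, hxU⟩⟩
  refine ord_pow_le_of_dvd ?_ ?_
  · intro h0
    exact normalizationι_app_ne_zero hW hWI hU hb
      (germ_injective_of_isIntegral (normalization (reducedSubscheme W)) x.1 hxU
        (h0.trans (map_zero _).symm))
  · rw [← map_pow]
    exact map_dvd _ hint

end Containment

/-! ### Points of the projective line as Cartier divisors -/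

section ProjectiveLine

theorem isRadical_of_surjective {k R : Type*} [Field k] [CommRing R] {I : Ideal R}
    (φ : k →+* R ⧸ I) (hφ : Function.Surjective φ) : I.IsRadical := by
  rw [Ideal.isRadical_iff_quotient_reduced]
  rcases subsingleton_or_nontrivial (R ⧸ I) with h | h
  · exact ⟨fun x _ => Subsingleton.elim _ _⟩
  · exact isReduced_of_injective (RingEquiv.ofBijective φ ⟨φ.injective, hφ⟩).symm
      (RingEquiv.injective _)

theorem isRadical_span_of_bijective {R S : Type*} [CommRing R] [CommRing S] (φ : R →+* S)
    (hφ : Function.Bijective φ) {a : R} (ha : (Ideal.span {a}).IsRadical) :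
    (Ideal.span {φ a}).IsRadical := by
  let e := RingEquiv.ofBijective φ hφ
  have h : Ideal.span {e a} = (Ideal.span {a}).comap e.symm := by
    rw [Ideal.comap_symm, Ideal.map_span, Set.image_singleton]
  exact (congrArg Ideal.IsRadical h).mpr (ha.comap e.symm)

theorem ideal_vanishingIdeal_compl_eq_span {X : Scheme.{u}} {O U : X.Opens} (hU : IsAffineOpen U)
    {s : Γ(X, U)} (hs : hU.fromSpec ⁻¹ᵁ O = PrimeSpectrum.basicOpen s)
    (hrad : (Ideal.span {s}).IsRadical) :
    (Scheme.IdealSheafData.vanishingIdeal O.compl).ideal ⟨U, hU⟩ = Ideal.span {s} := by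
  have h : hU.fromSpec ⁻¹' (O.compl : Set X) = PrimeSpectrum.zeroLocus {s} := by
    apply compl_injective
    have h : (hU.fromSpec ⁻¹' (O.compl : Set X))ᶜ = (hU.fromSpec ⁻¹ᵁ O : Set (Spec Γ(X, U))) :=
      compl_compl _
    exact (h.trans (congrArg (fun W : (Spec Γ(X, U)).Opens => (W : Set (Spec Γ(X, U)))) hs)).trans
      (PrimeSpectrum.basicOpen_eq_zeroLocus_compl s)
  refine (congrArg PrimeSpectrum.vanishingIdeal h).trans ?_
  rw [← PrimeSpectrum.zeroLocus_span, PrimeSpectrum.vanishingIdeal_zeroLocus_eq_radical,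
    hrad.radical]

theorem fromSpec_basicOpen {A : Type u} [CommRing A] {σ : Type*} [SetLike σ A]
    [AddSubgroupClass σ A] (𝒜 : ℕ → σ) [GradedRing 𝒜] {f : A} {m : ℕ} (hf : f ∈ 𝒜 m) (hm : 0 < m) :
    (Proj.isAffineOpen_basicOpen 𝒜 f hf hm).fromSpec =
      Spec.map (Proj.awayToSection 𝒜 f) ≫ Proj.awayι 𝒜 f hf hm := by
  rw [IsAffineOpen.fromSpec, Iso.inv_comp_eq, ← Proj.basicOpenIsoSpec_inv_ι, ← Category.assoc,
    ← Category.assoc]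
  have : (Proj.isAffineOpen_basicOpen 𝒜 f hf hm).isoSpec.hom ≫ Spec.map (Proj.awayToSection 𝒜 f) =
      (Proj.basicOpenIsoSpec 𝒜 f hf hm).hom := rfl
  rw [this, Iso.hom_inv_id, Category.id_comp]

theorem fromSpec_preimage_basicOpen {A : Type u} [CommRing A] {σ : Type*} [SetLike σ A]
    [AddSubgroupClass σ A] (𝒜 : ℕ → σ) [GradedRing 𝒜] {f g : A} {m n : ℕ} (hf : f ∈ 𝒜 m)
    (hm : 0 < m) (hg : g ∈ 𝒜 n) (hn : 0 < n) :
    (Proj.isAffineOpen_basicOpen 𝒜 f hf hm).fromSpec ⁻¹ᵁ Proj.basicOpen 𝒜 g =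
      PrimeSpectrum.basicOpen
        (Proj.awayToSection 𝒜 f (HomogeneousLocalization.Away.isLocalizationElem hf hg)) := by
  rw [fromSpec_basicOpen 𝒜 hf hm, Scheme.Hom.comp_preimage,
    Proj.awayι_preimage_basicOpen _ hf hm hg hn]
  rfl

open HomogeneousLocalization

variable (k : Type u) [Field k]

local notation "𝒜" => MvPolynomial.homogeneousSubmodule (Fin 2) k

theorem algebraMap_homogeneousSubmodule_zero_surjective :
    Function.Surjective (algebraMap k (MvPolynomial.homogeneousSubmodule (Fin 2) k 0)) := by
  rintro ⟨p, hp⟩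
  rw [MvPolynomial.homogeneousSubmodule_zero, Submodule.mem_one] at hp
  obtain ⟨c, hc⟩ := hp
  exact ⟨c, Subtype.ext hc⟩

theorem X_mem (i : Fin 2) : (MvPolynomial.X i : MvPolynomial (Fin 2) k) ∈
    MvPolynomial.homogeneousSubmodule (Fin 2) k 1 :=
  MvPolynomial.isHomogeneous_X k i

theorem adjoin_X_eq_top : Algebra.adjoin (MvPolynomial.homogeneousSubmodule (Fin 2) k 0)
    (Set.range (MvPolynomial.X : Fin 2 → MvPolynomial (Fin 2) k)) = ⊤ := by
  have h := MvPolynomial.adjoin_range_X (R := k) (σ := Fin 2)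
  rw [eq_top_iff] at h ⊢
  intro p _
  have hp : p ∈ Algebra.adjoin k (Set.range (MvPolynomial.X : Fin 2 → MvPolynomial (Fin 2) k)) :=
    h trivial
  induction hp using Algebra.adjoin_induction with
  | mem x hx => exact Algebra.subset_adjoin hx
  | algebraMap r => exact Subalgebra.algebraMap_mem _ (algebraMap k (𝒜 0) r)
  | add x y _ _ hx hy => exact add_mem (hx trivial) (hy trivial)
  | mul x y _ _ hx hy => exact mul_mem (hx trivial) (hy trivial)

variable {k} {l : MvPolynomial (Fin 2) k} (hl : l ∈ MvPolynomial.homogeneousSubmodule (Fin 2) k 1)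
  {c : k} (hlc : MvPolynomial.X 1 = l + MvPolynomial.C c * MvPolynomial.X 0)

include hlc

/-- With `ℓ = l / X₀`, the chart is generated by `y = X₁ / X₀ = ℓ + c`. Modulo `ℓ` this becomes the
constant `c`, so the quotient is an image of `k`, hence reduced. -/
theorem isRadical_span_isLocalizationElem :
    (Ideal.span {Away.isLocalizationElem (X_mem k 0) hl}).IsRadical := by
  set ℓ := Away.isLocalizationElem (X_mem k 0) hl with hℓ
  let π := Ideal.Quotient.mkₐ (𝒜 0) (Ideal.span {ℓ})
  let y : Away 𝒜 (MvPolynomial.X 0 : MvPolynomial (Fin 2) k) :=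
    Away.mk 𝒜 (X_mem k 0) 1 (MvPolynomial.X 1) (by simpa using X_mem k 1)
  have hy : y = ℓ + algebraMap (𝒜 0) _ (algebraMap k (𝒜 0) c) := by
    apply HomogeneousLocalization.val_injective
    rw [HomogeneousLocalization.val_add, Away.val_mk, Away.val_mk,
      HomogeneousLocalization.algebraMap_eq]
    change _ = _ + Localization.mk (MvPolynomial.C c) 1
    rw [Localization.add_mk, Localization.mk_eq_mk_iff, Localization.r_iff_exists]
    refine ⟨1, ?_⟩
    simp only [hlc, pow_one, Submonoid.coe_one, Submonoid.coe_mul]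
    ring
  have hπy : π y ∈ (⊥ : Subalgebra (𝒜 0) _) := by
    have : π ℓ = 0 := Ideal.Quotient.eq_zero_iff_mem.mpr (Ideal.mem_span_singleton_self ℓ)
    rw [hy, map_add, this, zero_add, AlgHom.commutes]
    exact Subalgebra.algebraMap_mem _ _
  have htop : (⊤ : Subalgebra (𝒜 0) (Away 𝒜 (MvPolynomial.X 0 : MvPolynomial (Fin 2) k))) ≤
      (⊥ : Subalgebra (𝒜 0) _).comap π := by
    rw [← Away.adjoin_mk_prod_pow_eq_top (X_mem k 0) (Fin 2) MvPolynomial.X (adjoin_X_eq_top k)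
      (fun _ => 1) (X_mem k), Algebra.adjoin_le_iff]
    rintro _ ⟨a, ai, hai, -, rfl⟩
    -- A generator `X₀ ^ i * X₁ ^ j / X₀ ^ (i + j)` equals `y ^ j`.
    refine Set.mem_of_eq_of_mem ?_ (pow_mem (show y ∈ Subalgebra.comap π ⊥ from hπy) (ai 1))
    apply HomogeneousLocalization.val_injective
    rw [HomogeneousLocalization.val_pow, Away.val_mk, Away.val_mk, Localization.mk_pow,
      Localization.mk_eq_mk_iff, Localization.r_iff_exists]
    refine ⟨1, ?_⟩
    have ha : a = ai 0 + ai 1 := by simpa using hai.symm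
    simp only [ha, Fin.prod_univ_two, pow_one, Submonoid.coe_one, SubmonoidClass.coe_pow]
    ring
  refine isRadical_of_surjective (((algebraMap (𝒜 0) _)).comp (algebraMap k (𝒜 0))) ?_
  rw [RingHom.coe_comp]
  refine Function.Surjective.comp (fun z => ?_) (algebraMap_homogeneousSubmodule_zero_surjective k)
  obtain ⟨z, rfl⟩ := Ideal.Quotient.mkₐ_surjective (𝒜 0) _ z
  exact Algebra.mem_bot.mp (htop (Algebra.mem_top (x := z)))

include hl

/-- The charts `X₀ ≠ 0` and `l ≠ 0` cover the line, with equations `l / X₀` and `1`. -/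
theorem isLocallyPrincipal_divisor : IsLocallyPrincipal (P1.divisor k l) := by
  intro x
  have hcov : ⨆ i, Proj.basicOpen 𝒜 (![MvPolynomial.X 0, l] i) = ⊤ := by
    refine Proj.iSup_basicOpen_eq_top' 𝒜 _ ?_ ?_
    · intro i
      fin_cases i
      · exact ⟨1, X_mem k 0⟩
      · exact ⟨1, hl⟩
    · rw [eq_top_iff, ← adjoin_X_eq_top k, Algebra.adjoin_le_iff]
      have h0 : (MvPolynomial.X 0 : MvPolynomial (Fin 2) k) ∈
          Algebra.adjoin (𝒜 0) (Set.range ![MvPolynomial.X 0, l]) :=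
        Algebra.subset_adjoin ⟨0, rfl⟩
      rintro _ ⟨i, rfl⟩
      fin_cases i
      · exact h0
      · refine Set.mem_of_eq_of_mem hlc (add_mem (Algebra.subset_adjoin ⟨1, rfl⟩)
          (mul_mem ?_ h0))
        exact Subalgebra.algebraMap_mem _ (algebraMap k (𝒜 0) c)
  obtain ⟨i, hi⟩ := Opens.mem_iSup.mp (hcov.ge (show x ∈ ⊤ from trivial))
  fin_cases i
  · refine ⟨⟨_, Proj.isAffineOpen_basicOpen 𝒜 (MvPolynomial.X 0) (X_mem k 0) one_pos⟩, hi,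
      ⟨_, ideal_vanishingIdeal_compl_eq_span _
        (fromSpec_preimage_basicOpen 𝒜 (X_mem k 0) one_pos hl one_pos) ?_⟩⟩
    have : IsIso (Proj.awayToSection 𝒜 (MvPolynomial.X 0 : MvPolynomial (Fin 2) k)) :=
      Proj.basicOpenIsoAway_hom 𝒜 (MvPolynomial.X 0) (X_mem k 0) one_pos ▸ inferInstance
    exact isRadical_span_of_bijective _ (ConcreteCategory.bijective_of_isIso
      (Proj.awayToSection 𝒜 (MvPolynomial.X 0 : MvPolynomial (Fin 2) k)))
      (isRadical_span_isLocalizationElem hl hlc)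
  · refine ⟨⟨_, Proj.isAffineOpen_basicOpen 𝒜 l hl one_pos⟩, hi,
      ⟨1, ideal_vanishingIdeal_compl_eq_span _ ?_ ?_⟩⟩
    · rw [PrimeSpectrum.basicOpen_one]
      exact IsAffineOpen.fromSpec_preimage_self _
    · rw [Ideal.span_singleton_one]
      exact fun _ _ => trivial

omit hl hlc

variable (k)

theorem isLocallyPrincipal_zero : IsLocallyPrincipal (P1.zero k) :=
  isLocallyPrincipal_divisor (X_mem k 1) (c := 0) (by simp)

theorem isLocallyPrincipal_one : IsLocallyPrincipal (P1.one k) :=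
  isLocallyPrincipal_divisor (sub_mem (X_mem k 1) (X_mem k 0)) (c := 1) (by simp)

instance locallyOfFiniteType_P1_str : LocallyOfFiniteType (P1.str k) := by
  have : IsScalarTower k (𝒜 0) (MvPolynomial (Fin 2) k) :=
    ⟨fun a b p => smul_mul_assoc a b.1 p⟩
  have : Algebra.FiniteType (𝒜 0) (MvPolynomial (Fin 2) k) :=
    .of_restrictScalars_finiteType k (𝒜 0) _
  have : LocallyOfFiniteType (Spec.map (CommRingCat.ofHom (algebraMap k (𝒜 0)))) := by
    rw [HasRingHomProperty.Spec_iff (P := @LocallyOfFiniteType)]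
    exact RingHom.FiniteType.of_surjective _ (algebraMap_homogeneousSubmodule_zero_surjective k)
  exact locallyOfFiniteType_comp _ _

end ProjectiveLine

/-- By induction: the empty wide pullback is `S`, and splitting off the first factor gives a binary
pullback. -/
theorem locallyOfFiniteType_base {S : Scheme.{u}} : ∀ {N : ℕ} {X : Fin N → Scheme.{u}}
    (f : ∀ i, X i ⟶ S) [∀ i, LocallyOfFiniteType (f i)],
    LocallyOfFiniteType (WidePullback.base f)
  | 0, X, f, _ => by
    obtain ⟨e, he⟩ : ∃ e : S ⟶ widePullback S X f, e ≫ WidePullback.base f = 𝟙 S :=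
      ⟨WidePullback.lift (𝟙 S) (fun i => i.elim0) (fun i => i.elim0),
        WidePullback.lift_base _ _ _ _⟩
    have : IsIso (WidePullback.base f) := by
      refine ⟨e, WidePullback.hom_ext _ _ _ (fun i => i.elim0) ?_, he⟩
      rw [Category.assoc, he, Category.comp_id, Category.id_comp]
    infer_instance
  | N + 1, X, f, _ => by
    have hq : LocallyOfFiniteType (WidePullback.base fun i : Fin N => f i.succ) :=
      locallyOfFiniteType_base _
    have hπ (i : Fin N) := WidePullback.π_arrow (fun i : Fin N => f i.succ) i
    obtain ⟨a, ha₀, ha, haq⟩ : ∃ a : widePullback S X f ⟶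
        pullback (f 0) (WidePullback.base fun i : Fin N => f i.succ),
        a ≫ pullback.fst _ _ = WidePullback.π f 0 ∧
        (∀ i, a ≫ pullback.snd _ _ ≫ WidePullback.π _ i = WidePullback.π f i.succ) ∧
        a ≫ pullback.snd _ _ ≫ WidePullback.base _ = WidePullback.base f := by
      have h := WidePullback.lift_base (fun i : Fin N => f i.succ) (WidePullback.base f)
        (fun i => WidePullback.π f i.succ) fun i => WidePullback.π_arrow f i.succ
      refine ⟨pullback.lift (WidePullback.π f 0)
        (WidePullback.lift (WidePullback.base f) (fun i => WidePullback.π f i.succ)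
          fun i => WidePullback.π_arrow f i.succ)
        ((WidePullback.π_arrow f 0).trans h.symm), pullback.lift_fst _ _ _, fun i => ?_, ?_⟩
      · rw [← Category.assoc, pullback.lift_snd]
        exact WidePullback.lift_π _ _ _ _ _
      · rw [← Category.assoc, pullback.lift_snd, h]
    obtain ⟨b, hb₀, hb, hbq⟩ : ∃ b : pullback (f 0) (WidePullback.base fun i : Fin N => f i.succ) ⟶
        widePullback S X f, b ≫ WidePullback.π f 0 = pullback.fst _ _ ∧
        (∀ i : Fin N, b ≫ WidePullback.π f i.succ = pullback.snd _ _ ≫ WidePullback.π _ i) ∧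
        b ≫ WidePullback.base f = pullback.snd _ _ ≫ WidePullback.base _ := by
      let p : ∀ i, pullback (f 0) (WidePullback.base fun i : Fin N => f i.succ) ⟶ X i :=
        Fin.cons (pullback.fst _ _) fun i => pullback.snd _ _ ≫ WidePullback.π _ i
      have hp : ∀ i, p i ≫ f i = pullback.snd _ _ ≫ WidePullback.base _ := by
        refine Fin.cases pullback.condition fun i => ?_
        exact (Category.assoc _ _ _).trans (congrArg _ (hπ i))
      exact ⟨WidePullback.lift _ p hp, WidePullback.lift_π _ _ _ _ _,
        fun i => WidePullback.lift_π _ _ _ _ _, WidePullback.lift_base _ _ _ _⟩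
    have hab : a ≫ b = 𝟙 _ := by
      refine WidePullback.hom_ext _ _ _ (fun i => ?_) ?_
      · refine Fin.cases ?_ (fun i => ?_) i
        · rw [Category.assoc, hb₀, ha₀, Category.id_comp]
        · rw [Category.assoc, hb, ha, Category.id_comp]
      · rw [Category.assoc, hbq, haq, Category.id_comp]
    have hba : b ≫ a = 𝟙 _ := by
      apply pullback.hom_ext
      · rw [Category.assoc, ha₀, hb₀, Category.id_comp]
      · refine WidePullback.hom_ext _ _ _ (fun i => ?_) ?_
        · rw [Category.id_comp, Category.assoc, Category.assoc, ha, hb]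
        · rw [Category.id_comp, Category.assoc, Category.assoc, haq, hbq]
    have : IsIso a := ⟨b, hab, hba⟩
    rw [← haq]
    infer_instance

instance {k : Type u} [Field k] (n : ℕ) : LocallyOfFiniteType (Bhat.str k n) := by
  have : LocallyOfFiniteType (P1Pow.str k (n - 1)) := locallyOfFiniteType_base _
  exact locallyOfFiniteType_comp _ _

/-! ### Transfer of the modulus conditions to closed subsets -/

section Modulus

variable {k : Type u} [Field k] {X : Scheme.{u}} {f : X ⟶ Spec (.of k)} {n : ℕ}

theorem isLocallyPrincipal_F0 : IsLocallyPrincipal (F0 k n) :=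
  (isLocallyPrincipal_zero k).comap _

theorem isLocallyPrincipal_F1i (i : Fin (n - 1)) : IsLocallyPrincipal (F1i k n i) :=
  (isLocallyPrincipal_one k).comap _

theorem isLocallyPrincipal_F1 : IsLocallyPrincipal (F1 k n) :=
  isLocallyPrincipal_prod _ _ fun i _ => isLocallyPrincipal_F1i i

theorem not_mem_support_F0 {x : XBhat f n} (hx : x ∈ XB f n) :
    x ∉ ((F0 k n).comap (XBhat.proj f n)).support := by
  have h : (Bhat.t k n) ((XBhat.proj f n) x) ∈ P1.nonvanishing k (MvPolynomial.X 1) :=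
    hx.1.1
  rw [F0, P1.zero, P1.divisor, Scheme.IdealSheafData.support_comap,
    Scheme.IdealSheafData.support_comap]
  have hZ := Scheme.IdealSheafData.coe_support_vanishingIdeal
    (P1.nonvanishing k (MvPolynomial.X 1)).compl
  exact fun hx' => hZ.le hx' h

theorem closureHat_mono {W V : IrreducibleCloseds ↥(XB f n)} (h : (W : Set ↥(XB f n)) ⊆ V) :
    closureHat W ≤ closureHat V :=
  closure_mono (Set.image_mono h)

theorem pullbackDivisor_le_of_subset [LocallyOfFiniteType f] {V W : IrreducibleCloseds ↥(XB f n)}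
    (hWV : (W : Set ↥(XB f n)) ⊆ V) {D : (Bhat k n).IdealSheafData} (hD : IsLocallyPrincipal D)
    {m : ℕ} (H : m • pullbackDivisor V (F0 k n) ≤ pullbackDivisor V D) :
    m • pullbackDivisor W (F0 k n) ≤ pullbackDivisor W D := by
  refine weilDivisor_le_of_closeds_le (pullback.fst f (Bhat.str k n) ≫ f)
    (isIrreducible_closureHat V) (isIrreducible_closureHat W) (closureHat_mono hWV)
    (isLocallyPrincipal_F0.comap _) (hD.comap _) (fun h => ?_) H
  -- Any point of `W` lies over `𝔾ₘ`, so the closure of `W` is not contained in `{t = 0}`.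
  obtain ⟨w, hw⟩ := W.isIrreducible.nonempty
  exact not_mem_support_F0 w.2 (h (subset_closure ⟨w, hw, rfl⟩))

end Modulus

theorem IsIrreducibleComponentOf.subset {T : Type*} [TopologicalSpace T] {W Z : Set T}
    (h : IsIrreducibleComponentOf W Z) : W ⊆ Z := by
  obtain ⟨C, -, rfl⟩ := h
  exact Subtype.coe_image_subset Z C

end AdditiveChow

theorem proposition2p3 {k : Type u} [Field k] [PerfectField k]
    {X : Scheme.{u}} (f : X ⟶ Spec (.of k)) [IsSeparated f] [LocallyOfFiniteType f]
    [QuasiCompact f] (n m : ℕ) (hn : 1 ≤ n) (hm : 1 ≤ m)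
    (V Y : IrreducibleCloseds ↥(AdditiveChow.XB f n))
    (hY0 : AdditiveChow.MeetsProperly (AdditiveChow.closureHat Y)
      ((AdditiveChow.F0 k n).comap (AdditiveChow.XBhat.proj f n)))
    (hY1 : AdditiveChow.MeetsProperly (AdditiveChow.closureHat Y)
      ((AdditiveChow.F1 k n).comap (AdditiveChow.XBhat.proj f n)))
    (W : IrreducibleCloseds ↥(AdditiveChow.XB f n))
    (hW : AdditiveChow.IsIrreducibleComponentOf (W : Set ↥(AdditiveChow.XB f n))
      ((V : Set ↥(AdditiveChow.XB f n)) ∩ (Y : Set ↥(AdditiveChow.XB f n)))) :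
    (AdditiveChow.ModulusSSup m V → AdditiveChow.ModulusSSup m W) ∧
      (AdditiveChow.ModulusSum m V → AdditiveChow.ModulusSum m W) := by
  have hWV := hW.subset.trans Set.inter_subset_left
  exact ⟨fun ⟨i, hi⟩ => ⟨i, AdditiveChow.pullbackDivisor_le_of_subset hWV
    (AdditiveChow.isLocallyPrincipal_F1i i) hi⟩,
    AdditiveChow.pullbackDivisor_le_of_subset hWV AdditiveChow.isLocallyPrincipal_F1⟩
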